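/- \textbf{Conventions.} Rings and algebras need not have a unit. A generalized Boolean algebra is a distributive lattice with relative complements and a least element $\emptyset$. A \emph{generalized Boolean dynamical system} $(\mathcal B,\mathcal L,\theta,\mathcal I)$ consists of a generalized Boolean algebra $\mathcal B$, a set $\mathcal L$, a morphism of generalized Boolean algebras $\theta_\alpha:\mathcal B\to\mathcal B$ for each $\alpha\in\mathcal L$, and a (non-empty) ideal $\mathcal I_\alpha$ of $\mathcal B$ for each $\alpha\in\mathcal L$ that contains every $A\in\mathcal B$ with $A\subseteq\theta_\alpha(B)$ for some $B\in\mathcal B$. Put $\Delta_A=\{\alpha\in\mathcal L:\theta_\alpha(A)\ne\emptyset\}$; $A$ is \emph{regular} if $0<|\Delta_B|<\infty$ for all $\emptyset\ne B\subseteq A$. For a unital commutative ring $R$, $L_R(\mathcal B,\mathcal L,\theta,\mathcal I)$ is the $R$-algebra generated by symbols $p_A$ ($A\in\mathcal B$) and $s_{\alpha,B},s^*_{\alpha,B}$ ($\alpha\in\mathcal L$, $B\in\mathcal I_\alpha$) subject to \begin{enumerate} \item $p_\emptyset=0$, $p_{A\cap A'}=p_Ap_{A'}$, $p_{A\cup A'}=p_A+p_{A'}-p_{A\cap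 A'}$; \item $p_As_{\alpha,B}=s_{\alpha,B}p_{\theta_\alpha(A)}$, $s^*_{\alpha,B}p_A=p_{\theta_\alpha(A)}s^*_{\alpha,B}$; \item $s^*_{\alpha,B}s_{\alpha',B'}=\delta_{\alpha,\alpha'}p_{B\cap B'}$; \item $s_{\alpha,B}p_{B'}=s_{\alpha,B\cap B'}$, $p_{B'}s^*_{\alpha,B}=s^*_{\alpha,B\cap B'}$ for $B'\in\mathcal B$; \item $p_A=\sum_{\alpha\in\Delta_A}s_{\alpha,\theta_\alpha(A)}s^*_{\alpha,\theta_\alpha(A)}$ for all regular $A$. \end{enumerate} It is $\mathbb Z$-graded with $\deg p_A=0$, $\deg s_{\alpha,B}=1$, $\deg s^*_{\alpha,B}=-1$. For a ring $S$, an \emph{$S$-system} $(P,Q,\psi)$ consists of $S$-bimodules $P,Q$ and an $S$-bimodule homomorphism $\psi:P\otimes_SQ\to S$. Put $\theta_{q,p}(x)=q\,\psi(p\otimes x)$ for $x\in Q$ and $\theta_{p,q}(y)=\psi(y\otimes q)\,p$ for $y\in P$, and let $\mathcal F_P(Q)$ and $\mathcal F_Q(P)$ be the additive groups spanned by the operators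 $\theta_{q,p}$ and $\theta_{p,q}$. Condition (FS): for all finite sets $F\subseteq Q$, $G\subseteq P$ there are $\Theta\in\mathcal F_P(Q)$ and $\Theta'\in\mathcal F_Q(P)$ with $\Theta x=x$ for $x\in F$ and $\Theta'y=y$ for $y\in G$. Let $\Delta(s):Q\to Q$, $x\mapsto sx$. A two-sided ideal $K$ of $S$ is \emph{$\psi$-compatible} if $\Delta(K)\subseteq\mathcal F_P(Q)$, and \emph{faithful} if $K\cap\ker\Delta=0$. The ring $\mathcal O_{(P,Q,\psi)}(K)$ is the universal ring generated by additive images $\sigma(S),T(Q),U(P)$ of $S,Q,P$, with $\sigma$ multiplicative, $T,U$ compatible with both module actions via $\sigma$, $\sigma(\psi(p\otimes q))=U(p)T(q)$, and $\sigma(s)=\sum_iT(q_i)U(p_i)$ whenever $s\in K$ and $\Delta(s)=\sum_i\theta_{q_i,p_i}$; it is $\mathbb Z$-graded with $\sigma(S),T(Q),U(P)$ in degrees $0,1,-1$. If (FS) holds and there is a faithful $\psi$-compatible ideal $K$ containing all others, the \emph{Cuntz--Pimsner ring} $\mathcal O_{(P,Q,\psi)}$ is defined to be $\mathcal O_{(P,Q,\psi)}(K)$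 for this $K$. \textbf{Theorem.} Let $(\mathcal B,\mathcal L,\theta,\mathcal I)$ be a generalized Boolean dynamical system and $R$ a unital commutative ring. Then there exist a subring $S\subseteq L_R(\mathcal B,\mathcal L,\theta,\mathcal I)$ and an $S$-system $(J,I,\psi)$ for which the Cuntz--Pimsner ring $\mathcal O_{(J,I,\psi)}$ is defined, such that $L_R(\mathcal B,\mathcal L,\theta,\mathcal I)$ is isomorphic to $\mathcal O_{(J,I,\psi)}$ as a $\mathbb Z$-graded ring. -/

import Mathlib

/-! ### Non-unital algebras presented by generators and relations -/

/-- The generator `x` in the unital `R`-algebra presented by the relations `rel`. -/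
noncomputable def presentedGen (R : Type*) [CommRing R] {X : Type*}
    (rel : FreeAlgebra R X → FreeAlgebra R X → Prop) (x : X) : RingQuot rel :=
  RingQuot.mkAlgHom R rel (FreeAlgebra.ι R x)

/-- The (not necessarily unital) `R`-algebra generated by the set `X` subject to the relations
`rel`, for relations without constant term. It is realized as the non-unital subalgebra generated
by `X` inside the unital algebra with the same presentation; its universal property among
non-unital algebras is `PresentedAlgebra.existsUnique_lift`. -/
def PresentedAlgebra (R : Type*) [CommRing R] {X : Type*}
    (rel : FreeAlgebra R X → FreeAlgebra R X → Prop) : Type _ :=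
  ↥(NonUnitalAlgebra.adjoin R (Set.range (presentedGen R rel)))

namespace PresentedAlgebra

variable (R : Type*) [CommRing R] {X : Type*} (rel : FreeAlgebra R X → FreeAlgebra R X → Prop)

noncomputable instance : NonUnitalRing (PresentedAlgebra R rel) :=
  inferInstanceAs (NonUnitalRing ↥(NonUnitalAlgebra.adjoin R (Set.range (presentedGen R rel))))

noncomputable instance : Module R (PresentedAlgebra R rel) :=
  inferInstanceAs (Module R ↥(NonUnitalAlgebra.adjoin R (Set.range (presentedGen R rel))))

instance : IsScalarTower R (PresentedAlgebra R rel) (PresentedAlgebra R rel) :=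
  inferInstanceAs (IsScalarTower R ↥(NonUnitalAlgebra.adjoin R (Set.range (presentedGen R rel)))
    ↥(NonUnitalAlgebra.adjoin R (Set.range (presentedGen R rel))))

instance : SMulCommClass R (PresentedAlgebra R rel) (PresentedAlgebra R rel) :=
  inferInstanceAs (SMulCommClass R ↥(NonUnitalAlgebra.adjoin R (Set.range (presentedGen R rel)))
    ↥(NonUnitalAlgebra.adjoin R (Set.range (presentedGen R rel))))

/-- The inclusion into the unital algebra with the same presentation. -/
noncomputable def incl : PresentedAlgebra R rel →ₙₐ[R] RingQuot rel :=
  NonUnitalSubalgebraClass.subtype (NonUnitalAlgebra.adjoin R (Set.range (presentedGen R rel)))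

/-- The generator `x` in the presented non-unital algebra. -/
noncomputable def gen (x : X) : PresentedAlgebra R rel :=
  ⟨presentedGen R rel x, NonUnitalAlgebra.subset_adjoin R ⟨x, rfl⟩⟩

/-- When the generator `x` is given the degree `deg x`, this is the component of degree `n`: the
`R`-span of all products of (one or more) generators whose degrees add up to `n`. -/
noncomputable def component (deg : X → ℤ) (n : ℤ) : AddSubgroup (PresentedAlgebra R rel) :=
  (Submodule.span R {a : RingQuot rel | ∃ l : List X, l ≠ [] ∧ (l.map deg).sum = n ∧
    a = (l.map (presentedGen R rel)).prod}).toAddSubgroup.comap (incl R rel : _ →+ RingQuot rel)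

/-- Universal property: a family `f` in a non-unital algebra `A` that satisfies the relations
(evaluated in the unitization of `A`) extends to exactly one homomorphism. -/
theorem existsUnique_lift {A : Type*} [NonUnitalRing A] [Module R A] [IsScalarTower R A A]
    [SMulCommClass R A A] (f : X → A)
    (hf : ∀ a b, rel a b → FreeAlgebra.lift R (fun x => (f x : Unitization R A)) a =
      FreeAlgebra.lift R (fun x => (f x : Unitization R A)) b) :
    ∃! φ : PresentedAlgebra R rel →ₙₐ[R] A, ∀ x, φ (gen R rel x) = f x := by
  set Ψ : RingQuot rel →ₐ[R] Unitization R A :=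
    RingQuot.liftAlgHom R ⟨FreeAlgebra.lift R (fun x => (f x : Unitization R A)),
      fun {a b} h => hf a b h⟩ with hΨ
  have hgen : ∀ x, Ψ (presentedGen R rel x) = (f x : Unitization R A) := by
    intro x
    rw [hΨ, presentedGen, RingQuot.liftAlgHom_mkAlgHom_apply, FreeAlgebra.lift_ι_apply]
  have hmem : ∀ a ∈ NonUnitalAlgebra.adjoin R (Set.range (presentedGen R rel)),
      ((Ψ a).snd : Unitization R A) = Ψ a := by
    intro a ha
    refine NonUnitalAlgebra.adjoin_induction (p := fun a _ =>
      ((Ψ a).snd : Unitization R A) = Ψ a) ?_ ?_ ?_ ?_ ?_ ha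
    · rintro _ ⟨x, rfl⟩
      rw [hgen, Unitization.snd_inr]
    · intro a b _ _ h1 h2
      rw [map_add, Unitization.snd_add, Unitization.inr_add, h1, h2]
    · simp
    · intro a b _ _ h1 h2
      rw [map_mul, ← h1, ← h2, ← Unitization.inr_mul, Unitization.snd_inr]
    · intro r a _ h
      rw [map_smul, Unitization.snd_smul, Unitization.inr_smul, h]
  refine ⟨{ toFun := fun a => (Ψ (incl R rel a)).snd
            map_smul' := fun r a => by simp
            map_zero' := by simp
            map_add' := fun a b => by simp
            map_mul' := fun a b => ?_ }, ?_, ?_⟩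
  · apply Unitization.inr_injective (R := R)
    rw [Unitization.inr_mul, hmem (incl R rel (a * b)) (a * b).2, hmem (incl R rel a) a.2,
      hmem (incl R rel b) b.2, map_mul, map_mul]
  · intro x
    change (Ψ (presentedGen R rel x)).snd = f x
    rw [hgen, Unitization.snd_inr]
  · intro φ hφ
    ext a
    obtain ⟨a, ha⟩ := a
    refine NonUnitalAlgebra.adjoin_induction (p := fun a ha =>
      φ ⟨a, ha⟩ = (Ψ a).snd) ?_ ?_ ?_ ?_ ?_ ha
    · rintro _ ⟨x, rfl⟩
      rw [hgen, Unitization.snd_inr]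
      exact hφ x
    · intro a b ha hb h1 h2
      refine (map_add φ ⟨a, ha⟩ ⟨b, hb⟩).trans ?_
      rw [h1, h2, map_add, Unitization.snd_add]
    · refine (map_zero φ).trans ?_
      rw [map_zero, Unitization.snd_zero]
    · intro a b ha hb h1 h2
      apply Unitization.inr_injective (R := R)
      rw [hmem _ (mul_mem ha hb), map_mul, ← hmem _ ha, ← hmem _ hb, ← h1, ← h2,
        ← Unitization.inr_mul]
      exact congrArg _ (map_mul φ ⟨a, ha⟩ ⟨b, hb⟩)
    · intro r a ha h
      refine (map_smul φ r ⟨a, ha⟩).trans ?_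
      rw [h, map_smul, Unitization.snd_smul]

end PresentedAlgebra

/-! ### Graded rings and graded isomorphism -/

/-- The subgroups `𝒜 n` make the (possibly non-unital) ring `A` a `ℤ`-graded ring. -/
def IsIntGrading {A : Type*} [NonUnitalRing A] (𝒜 : ℤ → AddSubgroup A) : Prop :=
  DirectSum.IsInternal 𝒜 ∧ ∀ m n : ℤ, ∀ a ∈ 𝒜 m, ∀ b ∈ 𝒜 n, a * b ∈ 𝒜 (m + n)

/-- `A` with `𝒜` and `B` with `ℬ` are `ℤ`-graded rings, and they are graded isomorphic. -/
def GradedIsomorphic {A B : Type*} [NonUnitalRing A] [NonUnitalRing B]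
    (𝒜 : ℤ → AddSubgroup A) (ℬ : ℤ → AddSubgroup B) : Prop :=
  IsIntGrading 𝒜 ∧ IsIntGrading ℬ ∧
    ∃ Φ : A ≃+* B, ∀ n : ℤ, (𝒜 n).map (Φ : A →+ B) = ℬ n

/-! ### Generalized Boolean dynamical systems and their algebras -/

/-- A generalized Boolean dynamical system `(𝓑, Λ, θ, 𝓘)` on the generalized Boolean algebra `𝓑`
with alphabet `Λ`. -/
structure GenBooleanDynSystem (𝓑 : Type*) [GeneralizedBooleanAlgebra 𝓑] (Λ : Type*) where
  /-- The action `θ_α` of the letter `α`, a morphism of generalized Boolean algebras. -/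
  θ : Λ → LatticeHom 𝓑 𝓑
  map_bot : ∀ α, θ α ⊥ = ⊥
  map_sdiff : ∀ α A B, θ α (A \ B) = θ α A \ θ α B
  /-- The ideal `𝓘_α`. -/
  idl : Λ → Order.Ideal 𝓑
  mem_idl_of_le : ∀ α A B, A ≤ θ α B → A ∈ idl α

namespace GenBooleanDynSystem

variable {𝓑 : Type*} [GeneralizedBooleanAlgebra 𝓑] {Λ : Type*}

/-- `Δ_A`, the set of letters that act non-trivially on `A`. -/
def Δ (D : GenBooleanDynSystem 𝓑 Λ) (A : 𝓑) : Set Λ := {α | D.θ α A ≠ ⊥}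

/-- `A` is regular: `0 < |Δ_B| < ∞` for all non-empty `B ⊆ A`. -/
def IsRegular (D : GenBooleanDynSystem 𝓑 Λ) (A : 𝓑) : Prop :=
  ∀ B ≤ A, B ≠ ⊥ → (D.Δ B).Nonempty ∧ (D.Δ B).Finite

/-- The element `θ_α(A)` of `𝓘_α`. -/
def img (D : GenBooleanDynSystem 𝓑 Λ) (α : Λ) (A : 𝓑) : D.idl α :=
  ⟨D.θ α A, D.mem_idl_of_le α _ A le_rfl⟩

/-- The element `B ∩ A` of `𝓘_α`, for `B` in `𝓘_α`. -/
def cut (D : GenBooleanDynSystem 𝓑 Λ) {α : Λ} (B : D.idl α) (A : 𝓑) : D.idl α :=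
  ⟨(B : 𝓑) ⊓ A, (D.idl α).lower inf_le_left B.2⟩

/-- The generating symbols `p_A`, `s_{α,B}` and `s*_{α,B}`, where `B` is in `𝓘_α`. -/
inductive Gen (D : GenBooleanDynSystem 𝓑 Λ)
  | p (A : 𝓑)
  | s (α : Λ) (B : D.idl α)
  | sStar (α : Λ) (B : D.idl α)

/-- `p_A` has degree `0`, `s_{α,B}` has degree `1` and `s*_{α,B}` has degree `-1`. -/
def Gen.deg {D : GenBooleanDynSystem 𝓑 Λ} : D.Gen → ℤ
  | .p _ => 0
  | .s _ _ => 1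
  | .sStar _ _ => -1

variable (R : Type*) [CommRing R] (D : GenBooleanDynSystem 𝓑 Λ)

/-- The symbol `p_A` in the free algebra. -/
def pF (A : 𝓑) : FreeAlgebra R D.Gen := FreeAlgebra.ι R (Gen.p A)

/-- The symbol `s_{α,B}` in the free algebra. -/
def sF (α : Λ) (B : D.idl α) : FreeAlgebra R D.Gen := FreeAlgebra.ι R (Gen.s α B)

/-- The symbol `s*_{α,B}` in the free algebra. -/
def sStarF (α : Λ) (B : D.idl α) : FreeAlgebra R D.Gen := FreeAlgebra.ι R (Gen.sStar α B)

/-- The defining relations of `L_R(𝓑, Λ, θ, 𝓘)`. In `p_regular` the finite set `F` is `Δ_A`. -/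
inductive Rel : FreeAlgebra R D.Gen → FreeAlgebra R D.Gen → Prop
  | p_bot : Rel (D.pF R ⊥) 0
  | p_inf (A A' : 𝓑) : Rel (D.pF R (A ⊓ A')) (D.pF R A * D.pF R A')
  | p_sup (A A' : 𝓑) : Rel (D.pF R (A ⊔ A')) (D.pF R A + D.pF R A' - D.pF R (A ⊓ A'))
  | p_mul_s (A : 𝓑) (α : Λ) (B : D.idl α) :
      Rel (D.pF R A * D.sF R α B) (D.sF R α B * D.pF R (D.θ α A))
  | sStar_mul_p (A : 𝓑) (α : Λ) (B : D.idl α) :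
      Rel (D.sStarF R α B * D.pF R A) (D.pF R (D.θ α A) * D.sStarF R α B)
  | sStar_mul_s (α : Λ) (B B' : D.idl α) :
      Rel (D.sStarF R α B * D.sF R α B') (D.pF R ((B : 𝓑) ⊓ (B' : 𝓑)))
  | sStar_mul_s_of_ne (α α' : Λ) (h : α ≠ α') (B : D.idl α) (B' : D.idl α') :
      Rel (D.sStarF R α B * D.sF R α' B') 0
  | s_mul_p (α : Λ) (B : D.idl α) (B' : 𝓑) :
      Rel (D.sF R α B * D.pF R B') (D.sF R α (D.cut B B'))
  | p_mul_sStar (α : Λ) (B : D.idl α) (B' : 𝓑) :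
      Rel (D.pF R B' * D.sStarF R α B) (D.sStarF R α (D.cut B B'))
  | p_regular (A : 𝓑) (hA : D.IsRegular A) (F : Finset Λ) (hF : (F : Set Λ) = D.Δ A) :
      Rel (D.pF R A) (∑ α ∈ F, D.sF R α (D.img α A) * D.sStarF R α (D.img α A))

/-- The generalized Boolean dynamical system algebra `L_R(𝓑, Λ, θ, 𝓘)`. -/
abbrev BooleanAlg : Type _ := PresentedAlgebra R (D.Rel R)

/-- The homogeneous component of degree `n` of `L_R(𝓑, Λ, θ, 𝓘)`. -/
noncomputable def grading (n : ℤ) : AddSubgroup (D.BooleanAlg R) :=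
  PresentedAlgebra.component R (D.Rel R) Gen.deg n

end GenBooleanDynSystem

/-! ### Systems over a non-unital ring and their Cuntz–Pimsner rings -/

/-- A bimodule over the (possibly non-unital) ring `S`: biadditive left and right actions that are
associative and commute with each other. -/
class NUBimodule (S M : Type*) [NonUnitalRing S] [AddCommGroup M] where
  /-- `lact s m` is `s m`. -/
  lact : S →+ M →+ M
  /-- `ract s m` is `m s`. -/
  ract : S →+ M →+ M
  mul_lact : ∀ s t m, lact (s * t) m = lact s (lact t m)
  mul_ract : ∀ s t m, ract (s * t) m = ract t (ract s m)
  lact_ract : ∀ s t m, lact s (ract t m) = ract t (lact s m)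

open scoped TensorProduct in
/-- The tensor product `P ⊗_S Q`: the quotient of `P ⊗_ℤ Q` by the elements
`p s ⊗ q - p ⊗ s q`. -/
abbrev NUTensor (S P Q : Type*) [NonUnitalRing S] [AddCommGroup P] [AddCommGroup Q]
    [NUBimodule S P] [NUBimodule S Q] : Type _ :=
  (P ⊗[ℤ] Q) ⧸ AddSubgroup.closure {t : P ⊗[ℤ] Q | ∃ (p : P) (s : S) (q : Q),
    t = NUBimodule.ract s p ⊗ₜ[ℤ] q - p ⊗ₜ[ℤ] NUBimodule.lact s q}

open scoped TensorProduct in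
/-- The pure tensor `p ⊗ q` in `P ⊗_S Q`. -/
def NUTensor.tmul (S : Type*) {P Q : Type*} [NonUnitalRing S] [AddCommGroup P] [AddCommGroup Q]
    [NUBimodule S P] [NUBimodule S Q] (p : P) (q : Q) : NUTensor S P Q :=
  QuotientAddGroup.mk (p ⊗ₜ[ℤ] q)

/-- An `S`-system `(P, Q, ψ)`: two `S`-bimodules with an `S`-bimodule homomorphism
`ψ : P ⊗_S Q → S`. As the pure tensors generate `P ⊗_S Q`, with `s (p ⊗ q) = s p ⊗ q` and
`(p ⊗ q) s = p ⊗ q s`, linearity of `ψ` is required on them. -/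
structure RingSystem.{u} (S : Type u) [NonUnitalRing S] where
  P : Type u
  Q : Type u
  [addCommGroupP : AddCommGroup P]
  [addCommGroupQ : AddCommGroup Q]
  [bimoduleP : NUBimodule S P]
  [bimoduleQ : NUBimodule S Q]
  ψ : NUTensor S P Q →+ S
  ψ_lact : ∀ s p q, ψ (NUTensor.tmul S (NUBimodule.lact s p) q) = s * ψ (NUTensor.tmul S p q)
  ψ_ract : ∀ s p q, ψ (NUTensor.tmul S p (NUBimodule.ract s q)) = ψ (NUTensor.tmul S p q) * s

namespace RingSystem

attribute [instance] addCommGroupP addCommGroupQ bimoduleP bimoduleQ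

variable {S : Type*} [NonUnitalRing S] (X : RingSystem S)

/-- The value `ψ(p ⊗ q)`. -/
def pair (p : X.P) (q : X.Q) : S := X.ψ (NUTensor.tmul S p q)

/-- The operator `∑ θ_{q_i, p_i}` on `Q`, where `θ_{q,p}(x) = q ψ(p ⊗ x)`. These are the
elements of `𝓕_P(Q)`. -/
def finRankQ {n : ℕ} (q : Fin n → X.Q) (p : Fin n → X.P) (x : X.Q) : X.Q :=
  ∑ i, NUBimodule.ract (X.pair (p i) x) (q i)

/-- The operator `∑ θ_{p_i, q_i}` on `P`, where `θ_{p,q}(y) = ψ(y ⊗ q) p`. These are the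
elements of `𝓕_Q(P)`. -/
def finRankP {n : ℕ} (q : Fin n → X.Q) (p : Fin n → X.P) (y : X.P) : X.P :=
  ∑ i, NUBimodule.lact (X.pair y (q i)) (p i)

/-- Condition (FS): on any finite sets of elements of `Q` and of `P`, some operators of
`𝓕_P(Q)` and of `𝓕_Q(P)` act as the identity. -/
def ConditionFS : Prop :=
  (∀ F : Finset X.Q, ∃ (n : ℕ) (q : Fin n → X.Q) (p : Fin n → X.P),
      ∀ x ∈ F, X.finRankQ q p x = x) ∧
  (∀ F : Finset X.P, ∃ (n : ℕ) (q : Fin n → X.Q) (p : Fin n → X.P),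
      ∀ y ∈ F, X.finRankP q p y = y)

/-- The ideal `K` of `S` is `ψ`-compatible: each `s` in `K` acts on `Q` from the left by an
operator of `𝓕_P(Q)`. -/
def IsCompatible (K : TwoSidedIdeal S) : Prop :=
  ∀ s ∈ K, ∃ (n : ℕ) (q : Fin n → X.Q) (p : Fin n → X.P),
    ∀ x, NUBimodule.lact s x = X.finRankQ q p x

/-- The ideal `K` of `S` is faithful: only `0` in `K` acts as zero on `Q` from the left. -/
def IsFaithfulIdeal (K : TwoSidedIdeal S) : Prop :=
  ∀ s ∈ K, (∀ x : X.Q, NUBimodule.lact s x = 0) → s = 0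

/-- The generating symbols of the Cuntz–Pimsner ring: the images of `S`, `Q` and `P`. -/
inductive Gen
  | ofS (s : S)
  | ofQ (q : X.Q)
  | ofP (p : X.P)

/-- The images of `S`, `Q` and `P` have the degrees `0`, `1` and `-1`. -/
def Gen.deg {X : RingSystem S} : X.Gen → ℤ
  | .ofS _ => 0
  | .ofQ _ => 1
  | .ofP _ => -1

/-- The symbol for `s` in the free ring. -/
def sF (s : S) : FreeAlgebra ℤ X.Gen := FreeAlgebra.ι ℤ (Gen.ofS s)

/-- The symbol for `q` in the free ring. -/
def qF (q : X.Q) : FreeAlgebra ℤ X.Gen := FreeAlgebra.ι ℤ (Gen.ofQ q)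

/-- The symbol for `p` in the free ring. -/
def pF (p : X.P) : FreeAlgebra ℤ X.Gen := FreeAlgebra.ι ℤ (Gen.ofP p)

/-- The relations of a covariant representation of `(P, Q, ψ)` (all but the last one, which define
the Toeplitz ring) that is Cuntz–Pimsner invariant relative to `K` (the last one: an element
`s` of `K` that acts on `Q` as `∑ θ_{q_i, p_i}` is identified with `∑ q_i p_i`). -/
inductive Rel (K : TwoSidedIdeal S) : FreeAlgebra ℤ X.Gen → FreeAlgebra ℤ X.Gen → Prop
  | s_add (s t : S) : Rel K (X.sF (s + t)) (X.sF s + X.sF t)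
  | s_mul (s t : S) : Rel K (X.sF (s * t)) (X.sF s * X.sF t)
  | q_add (q q' : X.Q) : Rel K (X.qF (q + q')) (X.qF q + X.qF q')
  | p_add (p p' : X.P) : Rel K (X.pF (p + p')) (X.pF p + X.pF p')
  | q_lact (s : S) (q : X.Q) : Rel K (X.qF (NUBimodule.lact s q)) (X.sF s * X.qF q)
  | q_ract (s : S) (q : X.Q) : Rel K (X.qF (NUBimodule.ract s q)) (X.qF q * X.sF s)
  | p_lact (s : S) (p : X.P) : Rel K (X.pF (NUBimodule.lact s p)) (X.sF s * X.pF p)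
  | p_ract (s : S) (p : X.P) : Rel K (X.pF (NUBimodule.ract s p)) (X.pF p * X.sF s)
  | covariance (p : X.P) (q : X.Q) : Rel K (X.sF (X.pair p q)) (X.pF p * X.qF q)
  | invariance (s : S) (hs : s ∈ K) (n : ℕ) (q : Fin n → X.Q) (p : Fin n → X.P)
      (h : ∀ x, NUBimodule.lact s x = X.finRankQ q p x) :
      Rel K (X.sF s) (∑ i, X.qF (q i) * X.pF (p i))

/-- The Cuntz–Pimsner ring `𝓞_{(P,Q,ψ)}(K)` relative to the ideal `K`: the universal ring for
covariant representations that are Cuntz–Pimsner invariant relative to `K`. -/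
abbrev CPRing (K : TwoSidedIdeal S) : Type _ := PresentedAlgebra ℤ (X.Rel K)

/-- The homogeneous component of degree `n` of `𝓞_{(P,Q,ψ)}(K)`. -/
noncomputable def grading (K : TwoSidedIdeal S) (n : ℤ) : AddSubgroup (X.CPRing K) :=
  PresentedAlgebra.component ℤ (X.Rel K) Gen.deg n

/-- The Cuntz–Pimsner ring `𝓞_{(P,Q,ψ)}` is defined and equals `𝓞_{(P,Q,ψ)}(K)`: condition (FS)
holds, and `K` is a faithful `ψ`-compatible ideal that contains all others. -/
def IsCPIdeal (K : TwoSidedIdeal S) : Prop :=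
  X.ConditionFS ∧ IsGreatest {K' : TwoSidedIdeal S | X.IsFaithfulIdeal K' ∧ X.IsCompatible K'} K

end RingSystem

/-! The system is found inside the algebra. Let `L` be the Boolean dynamical system algebra. Take
for `S` the `R`-span of the `p_A`, for `I` and `J` the spans of the `s_{α,B}` and of the `s*_{α,B}`,
and for all actions and `ψ` the product of `L`. The relations give the closure properties that this
requires, and associativity gives the axioms. An operator `∑ θ_{q_i,p_i}` on `I` is then left
multiplication by `∑ q_i p_i`, an element of the additive group `IJ` (`qpSpan`). The sums `∑
s_{α,B_α} s*_{α,B_α}` over finite sets of letters are local units, which gives (FS). They also show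
that an element of `IJ` annihilating `I` is zero (`eq_zero_of_mem_qpSpan`).

The ideal is `K = S ∩ IJ` (`cpIdeal`): compatible by construction, and faithful by the last remark.
For maximality, an element of a faithful compatible ideal is cut by idempotents `p_A` into disjoint
pieces `r p_A` of the same ideal (`pSpan_induction`). If `r ≠ 0`, faithfulness forces `Δ_B ≠ ∅` for
`∅ ≠ B ⊆ A`, and compatibility forces `Δ_B` to be finite. So `A` is regular, and relation (5) puts
`p_A` in `IJ` (`isRegular_of_smul_p_mem`, `p_mem_qpSpan`). This needs `r p_B ≠ 0` in `L`
(`smul_p_ne_zero`), which is seen in a representation on functions of boundary paths.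

The inclusions of `S`, `I`, `J` in `L` induce a map from the Cuntz–Pimsner ring to `L`. Invariance
holds because `s - ∑ q_i p_i` lies in `IJ` and annihilates `I` (`coe_eq_sum_of_lact_eq`). The
inverse comes from the presentation of `L`, with relation (5) supplied by invariance for `p_A ∈ K`.
It requires an `R`-algebra structure on the Cuntz–Pimsner ring, which is a priori only a ring
(`exists_scale`, `mul_scale_comm`). The two maps are inverse on generators and preserve degrees, so
no graded uniqueness theorem is needed. Both gradings exist because the relations are homogeneous
(`isIntGrading_component`). -/

namespace PresentedAlgebra

/-! ### Homogeneous components and gradings of presented algebras -/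

variable {R : Type*} [CommRing R] {X : Type*} {rel : FreeAlgebra R X → FreeAlgebra R X → Prop}

theorem incl_injective : Function.Injective (incl R rel) := Subtype.val_injective

@[simp]
theorem incl_gen (x : X) : incl R rel (gen R rel x) = RingQuot.mkAlgHom R rel (FreeAlgebra.ι R x) :=
  rfl

theorem mk_mem_span_words (l : List X) (hl : l ≠ []) :
    ∃ a : PresentedAlgebra R rel, incl R rel a = (l.map (presentedGen R rel)).prod := by
  induction l with
  | nil => exact absurd rfl hl
  | cons x l ih =>
    by_cases h : l = []
    · subst h
      exact ⟨gen R rel x, by simp [presentedGen]⟩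
    · obtain ⟨a, ha⟩ := ih h
      exact ⟨gen R rel x * a, by simp [ha, presentedGen]⟩

/-- Elements of a homogeneous component are sums of scaled words; induction over the words. -/
theorem component_induction {deg : X → ℤ} {motive : ℤ → PresentedAlgebra R rel → Prop}
    (zero : ∀ n, motive n 0)
    (add : ∀ n a b, motive n a → motive n b → motive n (a + b))
    (smul_gen : ∀ (r : R) x, motive (deg x) (r • gen R rel x))
    (gen_mul : ∀ x n a, motive n a → motive (deg x + n) (gen R rel x * a))
    {n : ℤ} {a : PresentedAlgebra R rel} (ha : a ∈ component R rel deg n) : motive n a := by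
  have word : ∀ l : List X, l ≠ [] → ∀ (r : R) (b : PresentedAlgebra R rel),
      incl R rel b = r • (l.map (presentedGen R rel)).prod → motive (l.map deg).sum b := by
    intro l
    induction l with
    | nil => exact fun h => absurd rfl h
    | cons x l ih =>
      intro _ r b hb
      by_cases h : l = []
      · subst h
        have : b = r • gen R rel x := incl_injective (by simpa [presentedGen] using hb)
        simpa [this] using smul_gen r x
      · obtain ⟨c, hc⟩ := mk_mem_span_words (rel := rel) l h
        -- The scalar is passed on to the tail of the word and ends at the last letter, so `gen_mul`
        -- needs no scalar.
        have : b = gen R rel x * (r • c) := incl_injective (by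
          simpa [presentedGen, hc] using hb)
        rw [this, List.map_cons, List.sum_cons]
        exact gen_mul x _ _ (ih h r _ (by rw [map_smul, hc]))
  have key : ∀ z ∈ Submodule.span R {a : RingQuot rel | ∃ l : List X, l ≠ [] ∧
      (l.map deg).sum = n ∧ a = (l.map (presentedGen R rel)).prod},
      ∃ b, incl R rel b = z ∧ motive n b := by
    intro z hz
    induction hz using Submodule.closure_induction with
    | zero => exact ⟨0, map_zero _, zero n⟩
    | add x y _ _ hx hy =>
      obtain ⟨b, rfl, hb⟩ := hx
      obtain ⟨c, rfl, hc⟩ := hy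
      exact ⟨b + c, map_add _ _ _, add n b c hb hc⟩
    | smul_mem r x hx =>
      obtain ⟨l, hl, hn, rfl⟩ := hx
      obtain ⟨c, hc⟩ := mk_mem_span_words (rel := rel) l hl
      refine ⟨r • c, by rw [map_smul, hc], ?_⟩
      rw [← hn]
      exact word l hl r _ (by rw [map_smul, hc])
  obtain ⟨b, hb, hm⟩ := key _ ha
  rwa [← incl_injective hb]

theorem gen_mem_component (deg : X → ℤ) (x : X) : gen R rel x ∈ component R rel deg (deg x) :=
  Submodule.subset_span ⟨[x], by simp, by simp, by simp [presentedGen]⟩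

theorem smul_mem_component {deg : X → ℤ} {n : ℤ} (r : R) {a : PresentedAlgebra R rel}
    (ha : a ∈ component R rel deg n) : r • a ∈ component R rel deg n := by
  have := Submodule.smul_mem _ r (show incl R rel a ∈ Submodule.span R _ from ha)
  rwa [← map_smul] at this

theorem mul_mem_component {deg : X → ℤ} {m n : ℤ} {a b : PresentedAlgebra R rel}
    (ha : a ∈ component R rel deg m) (hb : b ∈ component R rel deg n) :
    a * b ∈ component R rel deg (m + n) := by
  have hw : ∀ x n, ∀ b ∈ component R rel deg n,
      gen R rel x * b ∈ component R rel deg (deg x + n) := by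
    intro x n b hb
    change incl R rel _ ∈ Submodule.span R _
    rw [map_mul]
    refine Submodule.span_induction (p := fun z _ => incl R rel (gen R rel x) * z ∈
      Submodule.span R _) ?_ ?_ ?_ ?_ (show incl R rel b ∈ Submodule.span R _ from hb)
    · rintro _ ⟨l, hl, rfl, rfl⟩
      exact Submodule.subset_span ⟨x :: l, by simp, by simp, by simp [presentedGen]⟩
    · simp
    · intro y z _ _ hy hz
      rw [mul_add]
      exact add_mem hy hz
    · intro r y _ hy
      rw [mul_smul_comm]
      exact Submodule.smul_mem _ r hy
  refine component_induction (motive := fun m a => ∀ n, ∀ b ∈ component R rel deg n,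
    a * b ∈ component R rel deg (m + n)) ?_ ?_ ?_ ?_ ha n b hb
  · intro m n b _
    rw [zero_mul]
    exact zero_mem _
  · intro m a a' h h' n b hb
    rw [add_mul]
    exact add_mem (h n b hb) (h' n b hb)
  · intro r x n b hb
    rw [smul_mul_assoc]
    exact smul_mem_component r (hw x n b hb)
  · intro x m a h n b hb
    rw [mul_assoc, add_assoc]
    exact hw x _ _ (h n b hb)

theorem iSup_component (deg : X → ℤ) : ⨆ n, component R rel deg n = ⊤ := by
  rw [eq_top_iff]
  rintro ⟨a, ha⟩ -
  have hsm : ∀ (r : R), ∀ z ∈ ⨆ n, component R rel deg n, r • z ∈ ⨆ n, component R rel deg n := by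
    intro r z hz
    refine AddSubgroup.iSup_induction _ (C := fun z => r • z ∈ ⨆ n, component R rel deg n) hz
      ?_ ?_ ?_
    · intro n z hz
      exact AddSubgroup.mem_iSup_of_mem n (smul_mem_component r hz)
    · simp
    · intro x y hx hy
      rw [smul_add]
      exact add_mem hx hy
  refine NonUnitalAlgebra.adjoin_induction (p := fun a ha =>
      (⟨a, ha⟩ : PresentedAlgebra R rel) ∈ ⨆ n, component R rel deg n) ?_ ?_ ?_ ?_ ?_ ha
  · rintro _ ⟨x, rfl⟩
    exact AddSubgroup.mem_iSup_of_mem (deg x) (gen_mem_component deg x)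
  · intro a b ha hb h1 h2
    exact add_mem h1 h2
  · exact zero_mem _
  · intro a b ha hb h1 h2
    have hmul : ∀ u v : PresentedAlgebra R rel, u ∈ ⨆ n, component R rel deg n →
        v ∈ ⨆ n, component R rel deg n → u * v ∈ ⨆ n, component R rel deg n := by
      intro u v h1 h2
      refine AddSubgroup.iSup_induction _ (C := fun z : PresentedAlgebra R rel =>
        z * v ∈ ⨆ n, component R rel deg n) h1 ?_ ?_ ?_
      · intro m x hx
        refine AddSubgroup.iSup_induction _ (C := fun z : PresentedAlgebra R rel =>
          x * z ∈ ⨆ n, component R rel deg n) h2 ?_ ?_ ?_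
        · intro n y hy
          exact AddSubgroup.mem_iSup_of_mem (m + n) (mul_mem_component hx hy)
        · simp
        · intro y z hy hz
          rw [mul_add]
          exact add_mem hy hz
      · simp
      · intro y z hy hz
        rw [add_mul]
        exact add_mem hy hz
    exact hmul _ _ h1 h2
  · intro r a ha h
    exact hsm r _ h

theorem induction_on {motive : PresentedAlgebra R rel → Prop}
    (zero : motive 0) (add : ∀ a b, motive a → motive b → motive (a + b))
    (smul_gen : ∀ (r : R) x, motive (r • gen R rel x))
    (gen_mul : ∀ x a, motive a → motive (gen R rel x * a)) (a : PresentedAlgebra R rel) :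
    motive a := by
  -- Any degree function serves, since the components exhaust the algebra; here all degrees are `0`.
  have ha : a ∈ ⨆ n, component R rel (fun _ => 0) n := by
    rw [iSup_component]
    trivial
  refine AddSubgroup.iSup_induction _ (C := motive) ha ?_ zero add
  intro n x hx
  exact component_induction (motive := fun _ a => motive a) (fun _ => zero) (fun _ => add)
    smul_gen (fun x _ a => gen_mul x a) hx

/-- The span of the words of degree `n` in the free algebra. -/
def freeComponent (R : Type*) [CommRing R] {X : Type*} (deg : X → ℤ) (n : ℤ) :
    Submodule R (FreeAlgebra R X) :=
  Submodule.span R {a | ∃ l : List X, (l.map deg).sum = n ∧ a = (l.map (FreeAlgebra.ι R)).prod}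

theorem ι_mem_freeComponent {deg : X → ℤ} {n : ℤ} (x : X) (h : deg x = n) :
    FreeAlgebra.ι R x ∈ freeComponent R deg n :=
  Submodule.subset_span ⟨[x], by simpa using h, by simp⟩

theorem ι_mul_ι_mem_freeComponent {deg : X → ℤ} {n : ℤ} (x y : X) (h : deg x + deg y = n) :
    FreeAlgebra.ι R x * FreeAlgebra.ι R y ∈ freeComponent R deg n :=
  Submodule.subset_span ⟨[x, y], by simpa using h, by simp⟩

section Coaction

variable {deg : X → ℤ}

open AddMonoidAlgebra in
theorem lift_freeComponent (rel : FreeAlgebra R X → FreeAlgebra R X → Prop) {n : ℤ}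
    {a : FreeAlgebra R X} (ha : a ∈ freeComponent R deg n) :
    FreeAlgebra.lift R (fun x => (single (deg x) (presentedGen R rel x) :
      AddMonoidAlgebra (RingQuot rel) ℤ)) a = single n (RingQuot.mkAlgHom R rel a) := by
  refine Submodule.span_induction (p := fun a _ => FreeAlgebra.lift R (fun x =>
    (single (deg x) (presentedGen R rel x) : AddMonoidAlgebra (RingQuot rel) ℤ)) a =
      single n (RingQuot.mkAlgHom R rel a)) ?_ ?_ ?_ ?_ ha
  · rintro _ ⟨l, rfl, rfl⟩
    clear ha
    induction l with
    | nil => simp only [List.map_nil, List.prod_nil, map_one, List.sum_nil, one_def]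
    | cons x l ih =>
      simp only [List.map_cons, List.prod_cons, map_mul, List.sum_cons]
      rw [ih, FreeAlgebra.lift_ι_apply, AddMonoidAlgebra.single_mul_single]
      rfl
  · simp
  · intro x y _ _ hx hy
    rw [map_add, map_add, hx, hy, single_add]
  · intro r x _ hx
    rw [map_smul, map_smul, hx, smul_single]

variable (hrel : ∀ a b, rel a b → ∃ n, a ∈ freeComponent R deg n ∧ b ∈ freeComponent R deg n)
include hrel

-- The assignment `x ↦ x t^{deg x}` respects homogeneous relations, hence defines a homomorphism
-- into Laurent polynomials over the algebra. It records the degree of an element as the exponent of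
-- `t`.
open AddMonoidAlgebra in
theorem exists_coaction : ∃ Ψ : RingQuot rel →ₐ[R] AddMonoidAlgebra (RingQuot rel) ℤ,
    ∀ n, ∀ a ∈ component R rel deg n, Ψ (incl R rel a) = single n (incl R rel a) := by
  let Ψ : RingQuot rel →ₐ[R] AddMonoidAlgebra (RingQuot rel) ℤ :=
    RingQuot.liftAlgHom R ⟨FreeAlgebra.lift R (fun x => (single (deg x) (presentedGen R rel x) :
      AddMonoidAlgebra (RingQuot rel) ℤ)), by
      intro a b h
      obtain ⟨n, ha, hb⟩ := hrel a b h
      rw [lift_freeComponent rel ha, lift_freeComponent rel hb, RingQuot.mkAlgHom_rel R h]⟩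
  have hgen : ∀ x, Ψ (incl R rel (gen R rel x)) = single (deg x) (incl R rel (gen R rel x)) := by
    intro x
    rw [incl_gen, RingQuot.liftAlgHom_mkAlgHom_apply, FreeAlgebra.lift_ι_apply]
    rfl
  refine ⟨Ψ, fun n a ha => component_induction (motive := fun n a => Ψ (incl R rel a) =
    single n (incl R rel a)) ?_ ?_ ?_ ?_ ha⟩
  · simp
  · intro n a b h1 h2
    rw [map_add, map_add, h1, h2, single_add]
  · intro r x
    rw [map_smul, map_smul, hgen, smul_single]
  · intro x n a h
    rw [map_mul, map_mul, hgen, h, AddMonoidAlgebra.single_mul_single]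

theorem isIntGrading_component : IsIntGrading (component R rel deg) := by
  refine ⟨⟨?_, ?_⟩, fun m n a ha b hb => mul_mem_component ha hb⟩
  · obtain ⟨Ψ, hΨ⟩ := exists_coaction hrel
    rw [injective_iff_map_eq_zero]
    intro d hd
    ext n
    -- The `n`-th coefficient after the coaction recovers the `n`-th summand, so a family with sum
    -- zero vanishes.
    have key : ∀ d : DirectSum ℤ fun n => component R rel deg n,
        (Ψ (incl R rel (DirectSum.coeAddMonoidHom (component R rel deg) d))).coeff n =
          incl R rel (d n : PresentedAlgebra R rel) := by
      intro d
      induction d using DirectSum.induction_on with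
      | zero => simp
      | of i x =>
        rw [DirectSum.coeAddMonoidHom_of, hΨ i _ x.2]
        by_cases h : i = n
        · subst h
          rw [AddMonoidAlgebra.coeff_single, Finsupp.single_eq_same, DirectSum.of_eq_same]
        · rw [DirectSum.of_eq_of_ne _ _ _ (Ne.symm h)]
          rw [AddMonoidAlgebra.coeff_single, Finsupp.single_eq_of_ne (Ne.symm h)]
          simp
      | add x y hx hy =>
        simp only [map_add, DirectSum.add_apply, AddSubgroup.coe_add, ← hx, ← hy]
        rfl
    have := key d
    rw [hd] at this
    apply incl_injective
    rw [← this]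
    simp
  · rw [← AddMonoidHom.range_eq_top, ← top_le_iff, ← iSup_component deg, iSup_le_iff]
    intro n a ha
    exact ⟨DirectSum.of _ n ⟨a, ha⟩, DirectSum.coeAddMonoidHom_of _ _ _⟩

end Coaction

end PresentedAlgebra

/-! ### Relations, universal property and grading of the Cuntz–Pimsner ring -/

namespace RingSystem

variable {S : Type*} [NonUnitalRing S] {X : RingSystem S} {K : TwoSidedIdeal S}

namespace CPRing

/-- The image of `s` in the Cuntz–Pimsner ring. -/
noncomputable def ofS (X : RingSystem S) (K : TwoSidedIdeal S) (s : S) : X.CPRing K :=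
  PresentedAlgebra.gen ℤ (X.Rel K) (Gen.ofS s)

/-- The image of `q` in the Cuntz–Pimsner ring. -/
noncomputable def ofQ (X : RingSystem S) (K : TwoSidedIdeal S) (q : X.Q) : X.CPRing K :=
  PresentedAlgebra.gen ℤ (X.Rel K) (Gen.ofQ q)

/-- The image of `p` in the Cuntz–Pimsner ring. -/
noncomputable def ofP (X : RingSystem S) (K : TwoSidedIdeal S) (p : X.P) : X.CPRing K :=
  PresentedAlgebra.gen ℤ (X.Rel K) (Gen.ofP p)

theorem ofS_add (s t : S) : ofS X K (s + t) = ofS X K s + ofS X K t :=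
  PresentedAlgebra.incl_injective (by
    simpa [ofS, sF] using RingQuot.mkAlgHom_rel ℤ (Rel.s_add (K := K) (X := X) s t))

theorem ofS_mul (s t : S) : ofS X K (s * t) = ofS X K s * ofS X K t :=
  PresentedAlgebra.incl_injective (by
    simpa [ofS, sF] using RingQuot.mkAlgHom_rel ℤ (Rel.s_mul (K := K) (X := X) s t))

theorem ofQ_add (q q' : X.Q) : ofQ X K (q + q') = ofQ X K q + ofQ X K q' :=
  PresentedAlgebra.incl_injective (by
    simpa [ofQ, qF] using RingQuot.mkAlgHom_rel ℤ (Rel.q_add (K := K) q q'))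

theorem ofP_add (p p' : X.P) : ofP X K (p + p') = ofP X K p + ofP X K p' :=
  PresentedAlgebra.incl_injective (by
    simpa [ofP, pF] using RingQuot.mkAlgHom_rel ℤ (Rel.p_add (K := K) p p'))

theorem ofQ_lact (s : S) (q : X.Q) : ofQ X K (NUBimodule.lact s q) = ofS X K s * ofQ X K q :=
  PresentedAlgebra.incl_injective (by
    simpa [ofQ, ofS, qF, sF] using RingQuot.mkAlgHom_rel ℤ (Rel.q_lact (K := K) s q))

theorem ofQ_ract (s : S) (q : X.Q) : ofQ X K (NUBimodule.ract s q) = ofQ X K q * ofS X K s :=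
  PresentedAlgebra.incl_injective (by
    simpa [ofQ, ofS, qF, sF] using RingQuot.mkAlgHom_rel ℤ (Rel.q_ract (K := K) s q))

theorem ofP_lact (s : S) (p : X.P) : ofP X K (NUBimodule.lact s p) = ofS X K s * ofP X K p :=
  PresentedAlgebra.incl_injective (by
    simpa [ofP, ofS, pF, sF] using RingQuot.mkAlgHom_rel ℤ (Rel.p_lact (K := K) s p))

theorem ofP_ract (s : S) (p : X.P) : ofP X K (NUBimodule.ract s p) = ofP X K p * ofS X K s :=
  PresentedAlgebra.incl_injective (by
    simpa [ofP, ofS, pF, sF] using RingQuot.mkAlgHom_rel ℤ (Rel.p_ract (K := K) s p))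

theorem ofS_pair (p : X.P) (q : X.Q) : ofS X K (X.pair p q) = ofP X K p * ofQ X K q :=
  PresentedAlgebra.incl_injective (by
    simpa [ofP, ofS, ofQ, pF, sF, qF] using RingQuot.mkAlgHom_rel ℤ (Rel.covariance (K := K) p q))

theorem ofS_eq_sum {s : S} (hs : s ∈ K) {n : ℕ} {q : Fin n → X.Q} {p : Fin n → X.P}
    (h : ∀ x, NUBimodule.lact s x = X.finRankQ q p x) :
    ofS X K s = ∑ i, ofQ X K (q i) * ofP X K (p i) :=
  PresentedAlgebra.incl_injective (by
    simpa [ofP, ofS, ofQ, pF, sF, qF] using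
      RingQuot.mkAlgHom_rel ℤ (Rel.invariance (K := K) s hs n q p h))

theorem ofS_zero : ofS X K 0 = 0 := by
  simpa using ofS_add (X := X) (K := K) 0 0

theorem ofQ_zero : ofQ X K 0 = 0 := by
  simpa using ofQ_add (X := X) (K := K) 0 0

theorem ofP_zero : ofP X K 0 = 0 := by
  simpa using ofP_add (X := X) (K := K) 0 0

/-- A covariant representation that is invariant relative to `K` extends to the Cuntz–Pimsner
ring. -/
theorem exists_lift {A : Type*} [NonUnitalRing A] (σ : S → A) (T : X.Q → A) (U : X.P → A)
    (σ_add : ∀ s t, σ (s + t) = σ s + σ t) (σ_mul : ∀ s t, σ (s * t) = σ s * σ t)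
    (T_add : ∀ q q', T (q + q') = T q + T q') (U_add : ∀ p p', U (p + p') = U p + U p')
    (T_lact : ∀ s q, T (NUBimodule.lact s q) = σ s * T q)
    (T_ract : ∀ s q, T (NUBimodule.ract s q) = T q * σ s)
    (U_lact : ∀ s p, U (NUBimodule.lact s p) = σ s * U p)
    (U_ract : ∀ s p, U (NUBimodule.ract s p) = U p * σ s)
    (σ_pair : ∀ p q, σ (X.pair p q) = U p * T q)
    (σ_inv : ∀ s ∈ K, ∀ (n : ℕ) (q : Fin n → X.Q) (p : Fin n → X.P),
      (∀ x, NUBimodule.lact s x = X.finRankQ q p x) → σ s = ∑ i, T (q i) * U (p i)) :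
    ∃ φ : X.CPRing K →ₙ+* A, (∀ s, φ (ofS X K s) = σ s) ∧ (∀ q, φ (ofQ X K q) = T q) ∧
      ∀ p, φ (ofP X K p) = U p := by
  obtain ⟨φ, hφ, -⟩ := PresentedAlgebra.existsUnique_lift ℤ (X.Rel K)
    (fun g : X.Gen => match g with
      | .ofS s => σ s
      | .ofQ q => T q
      | .ofP p => U p) (by
    intro a b h
    have hsum : ∀ (n : ℕ) (f : Fin n → A), ((∑ i, f i : A) : Unitization ℤ A) =
        ∑ i, (f i : Unitization ℤ A) := fun n f =>
      map_sum (Unitization.inrNonUnitalAlgHom ℤ A) f Finset.univ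
    -- Evaluated in the unitization, each relation is the image under the injection of `A` of one of
    -- the hypotheses.
    cases h <;> simp only [sF, qF, pF, map_add, map_mul, map_sum, FreeAlgebra.lift_ι_apply,
      ← Unitization.inr_add, ← Unitization.inr_mul, ← hsum] <;> apply congrArg <;>
      solve_by_elim)
  exact ⟨φ, fun s => hφ (.ofS s), fun q => hφ (.ofQ q), fun p => hφ (.ofP p)⟩

theorem induction_on {motive : X.CPRing K → Prop} (zero : motive 0)
    (add : ∀ a b, motive a → motive b → motive (a + b)) (neg : ∀ a, motive a → motive (-a))
    (mul : ∀ a b, motive a → motive b → motive (a * b))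
    (hS : ∀ s, motive (ofS X K s)) (hQ : ∀ q, motive (ofQ X K q)) (hP : ∀ p, motive (ofP X K p))
    (a : X.CPRing K) : motive a := by
  have gen : ∀ g, motive (PresentedAlgebra.gen ℤ (X.Rel K) g) := by
    rintro (s | q | p)
    exacts [hS s, hQ q, hP p]
  refine PresentedAlgebra.induction_on zero add ?_ (fun x a h => mul _ _ (gen x) h) a
  intro r x
  -- Integer multiples of a generator are reduced to sums and negatives; the `ℤ`-action of the
  -- presented algebra must first be identified with that of the additive group.
  refine (congrArg motive (int_smul_eq_zsmul _ r _)).mpr ?_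
  induction r using Int.induction_on with
  | zero => rwa [zero_zsmul]
  | succ n ih =>
    rw [add_zsmul, one_zsmul]
    exact add _ _ ih (gen x)
  | pred n ih =>
    rw [sub_zsmul, one_zsmul]
    exact add _ _ ih (neg _ (gen x))

end CPRing

theorem CPRing.ofS_mem (s : S) : ofS X K s ∈ X.grading K 0 :=
  PresentedAlgebra.gen_mem_component (R := ℤ) (rel := X.Rel K) Gen.deg (Gen.ofS s)

theorem CPRing.ofQ_mem (q : X.Q) : ofQ X K q ∈ X.grading K 1 :=
  PresentedAlgebra.gen_mem_component (R := ℤ) (rel := X.Rel K) Gen.deg (Gen.ofQ q)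

theorem CPRing.ofP_mem (p : X.P) : ofP X K p ∈ X.grading K (-1) :=
  PresentedAlgebra.gen_mem_component (R := ℤ) (rel := X.Rel K) Gen.deg (Gen.ofP p)

open PresentedAlgebra in
theorem isIntGrading_grading (X : RingSystem S) (K : TwoSidedIdeal S) :
    IsIntGrading (X.grading K) := by
  refine isIntGrading_component fun a b h => ?_
  cases h with
  | s_add s t | p_add s t | q_add s t =>
    exact ⟨_, ι_mem_freeComponent _ rfl, add_mem (ι_mem_freeComponent _ rfl)
      (ι_mem_freeComponent _ rfl)⟩
  | s_mul | q_lact | q_ract | p_lact | p_ract | covariance =>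
    exact ⟨_, ι_mem_freeComponent _ rfl, ι_mul_ι_mem_freeComponent _ _ rfl⟩
  | invariance =>
    exact ⟨_, ι_mem_freeComponent _ rfl, sum_mem fun i _ => ι_mul_ι_mem_freeComponent _ _ rfl⟩

end RingSystem

/-! ### Relations, universal property and grading of `L_R(𝓑, Λ, θ, 𝓘)` -/

namespace GenBooleanDynSystem

variable {𝓑 : Type*} [GeneralizedBooleanAlgebra 𝓑] {Λ : Type*}

namespace BooleanAlg

variable (R : Type*) [CommRing R] (D : GenBooleanDynSystem 𝓑 Λ)

/-- The element `p_A` of `L_R(𝓑, Λ, θ, 𝓘)`. -/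
noncomputable def p (A : 𝓑) : D.BooleanAlg R := PresentedAlgebra.gen R (D.Rel R) (Gen.p A)

/-- The element `s_{α,B}` of `L_R(𝓑, Λ, θ, 𝓘)`. -/
noncomputable def s (α : Λ) (B : D.idl α) : D.BooleanAlg R :=
  PresentedAlgebra.gen R (D.Rel R) (Gen.s α B)

/-- The element `s*_{α,B}` of `L_R(𝓑, Λ, θ, 𝓘)`. -/
noncomputable def sStar (α : Λ) (B : D.idl α) : D.BooleanAlg R :=
  PresentedAlgebra.gen R (D.Rel R) (Gen.sStar α B)

theorem p_bot : p R D ⊥ = 0 :=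
  PresentedAlgebra.incl_injective (by
    simpa [p, pF] using RingQuot.mkAlgHom_rel R (Rel.p_bot (R := R) (D := D)))

theorem p_inf (A A' : 𝓑) : p R D (A ⊓ A') = p R D A * p R D A' :=
  PresentedAlgebra.incl_injective (by
    simpa [p, pF] using RingQuot.mkAlgHom_rel R (Rel.p_inf (R := R) (D := D) A A'))

theorem p_sup (A A' : 𝓑) : p R D (A ⊔ A') = p R D A + p R D A' - p R D (A ⊓ A') :=
  PresentedAlgebra.incl_injective (by
    simpa [p, pF] using RingQuot.mkAlgHom_rel R (Rel.p_sup (R := R) (D := D) A A'))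

theorem p_mul_s (A : 𝓑) (α : Λ) (B : D.idl α) :
    p R D A * s R D α B = s R D α B * p R D (D.θ α A) :=
  PresentedAlgebra.incl_injective (by
    simpa [p, pF, s, sF] using RingQuot.mkAlgHom_rel R (Rel.p_mul_s (R := R) (D := D) A α B))

theorem sStar_mul_p (A : 𝓑) (α : Λ) (B : D.idl α) :
    sStar R D α B * p R D A = p R D (D.θ α A) * sStar R D α B :=
  PresentedAlgebra.incl_injective (by
    simpa [p, pF, sStar, sStarF] using
      RingQuot.mkAlgHom_rel R (Rel.sStar_mul_p (R := R) (D := D) A α B))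

theorem sStar_mul_s (α : Λ) (B B' : D.idl α) :
    sStar R D α B * s R D α B' = p R D ((B : 𝓑) ⊓ (B' : 𝓑)) :=
  PresentedAlgebra.incl_injective (by
    simpa [p, pF, s, sF, sStar, sStarF] using
      RingQuot.mkAlgHom_rel R (Rel.sStar_mul_s (R := R) (D := D) α B B'))

theorem sStar_mul_s_of_ne {α α' : Λ} (h : α ≠ α') (B : D.idl α) (B' : D.idl α') :
    sStar R D α B * s R D α' B' = 0 :=
  PresentedAlgebra.incl_injective (by
    simpa [s, sF, sStar, sStarF] using
      RingQuot.mkAlgHom_rel R (Rel.sStar_mul_s_of_ne (R := R) (D := D) α α' h B B'))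

theorem s_mul_p (α : Λ) (B : D.idl α) (B' : 𝓑) :
    s R D α B * p R D B' = s R D α (D.cut B B') :=
  PresentedAlgebra.incl_injective (by
    simpa [p, pF, s, sF] using RingQuot.mkAlgHom_rel R (Rel.s_mul_p (R := R) (D := D) α B B'))

theorem p_mul_sStar (α : Λ) (B : D.idl α) (B' : 𝓑) :
    p R D B' * sStar R D α B = sStar R D α (D.cut B B') :=
  PresentedAlgebra.incl_injective (by
    simpa [p, pF, sStar, sStarF] using
      RingQuot.mkAlgHom_rel R (Rel.p_mul_sStar (R := R) (D := D) α B B'))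

theorem p_regular {A : 𝓑} (hA : D.IsRegular A) {F : Finset Λ} (hF : (F : Set Λ) = D.Δ A) :
    p R D A = ∑ α ∈ F, s R D α (D.img α A) * sStar R D α (D.img α A) :=
  PresentedAlgebra.incl_injective (by
    simpa [p, pF, s, sF, sStar, sStarF] using
      RingQuot.mkAlgHom_rel R (Rel.p_regular (R := R) (D := D) A hA F hF))

variable {R D}

/-- The universal property of `L_R(𝓑, Λ, θ, 𝓘)`. -/
theorem exists_lift {A : Type*} [NonUnitalRing A] [Module R A] [IsScalarTower R A A]
    [SMulCommClass R A A] (p' : 𝓑 → A) (s' sStar' : ∀ α, D.idl α → A)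
    (p_bot : p' ⊥ = 0) (p_inf : ∀ B B', p' (B ⊓ B') = p' B * p' B')
    (p_sup : ∀ B B', p' (B ⊔ B') = p' B + p' B' - p' (B ⊓ B'))
    (p_mul_s : ∀ C α B, p' C * s' α B = s' α B * p' (D.θ α C))
    (sStar_mul_p : ∀ C α B, sStar' α B * p' C = p' (D.θ α C) * sStar' α B)
    (sStar_mul_s : ∀ α (B B' : D.idl α), sStar' α B * s' α B' = p' ((B : 𝓑) ⊓ (B' : 𝓑)))
    (sStar_mul_s_of_ne : ∀ α α' (B : D.idl α) (B' : D.idl α'), α ≠ α' →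
      sStar' α B * s' α' B' = 0)
    (s_mul_p : ∀ α B B', s' α B * p' B' = s' α (D.cut B B'))
    (p_mul_sStar : ∀ α B B', p' B' * sStar' α B = sStar' α (D.cut B B'))
    (p_regular : ∀ B, D.IsRegular B → ∀ F : Finset Λ, (F : Set Λ) = D.Δ B →
      p' B = ∑ α ∈ F, s' α (D.img α B) * sStar' α (D.img α B)) :
    ∃ φ : D.BooleanAlg R →ₙₐ[R] A, (∀ B, φ (p R D B) = p' B) ∧
      (∀ α B, φ (s R D α B) = s' α B) ∧ ∀ α B, φ (sStar R D α B) = sStar' α B := by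
  obtain ⟨φ, hφ, -⟩ := PresentedAlgebra.existsUnique_lift R (D.Rel R)
    (fun g : D.Gen => match g with
      | .p B => p' B
      | .s α B => s' α B
      | .sStar α B => sStar' α B) (by
    intro a b h
    have hsum : ∀ (F : Finset Λ) (f : Λ → A), ((∑ i ∈ F, f i : A) : Unitization R A) =
        ∑ i ∈ F, (f i : Unitization R A) := fun F f =>
      map_sum (Unitization.inrNonUnitalAlgHom R A) f F
    cases h <;> simp only [sF, sStarF, pF, map_add, map_sub, map_zero, map_mul, map_sum,
      FreeAlgebra.lift_ι_apply, ← Unitization.inr_add, ← Unitization.inr_mul,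
      ← Unitization.inr_sub, ← Unitization.inr_zero, ← hsum] <;> apply congrArg <;>
      solve_by_elim)
  exact ⟨φ, fun B => hφ (.p B), fun α B => hφ (.s α B), fun α B => hφ (.sStar α B)⟩

end BooleanAlg

variable {R : Type*} [CommRing R] {D : GenBooleanDynSystem 𝓑 Λ}

theorem BooleanAlg.p_mem_grading (A : 𝓑) : p R D A ∈ D.grading R 0 :=
  PresentedAlgebra.gen_mem_component (R := R) (rel := D.Rel R) Gen.deg (Gen.p A)

theorem BooleanAlg.s_mem_grading (α : Λ) (B : D.idl α) : s R D α B ∈ D.grading R 1 :=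
  PresentedAlgebra.gen_mem_component (R := R) (rel := D.Rel R) Gen.deg (Gen.s α B)

theorem BooleanAlg.sStar_mem_grading (α : Λ) (B : D.idl α) : sStar R D α B ∈ D.grading R (-1) :=
  PresentedAlgebra.gen_mem_component (R := R) (rel := D.Rel R) Gen.deg (Gen.sStar α B)

theorem smul_mem_grading {n : ℤ} (r : R) {a : D.BooleanAlg R} (ha : a ∈ D.grading R n) :
    r • a ∈ D.grading R n :=
  PresentedAlgebra.smul_mem_component r ha

variable (R D) in
theorem iSup_grading : ⨆ n, D.grading R n = ⊤ :=
  PresentedAlgebra.iSup_component Gen.deg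

open PresentedAlgebra in
theorem isIntGrading_grading (R : Type*) [CommRing R] (D : GenBooleanDynSystem 𝓑 Λ) :
    IsIntGrading (D.grading R) := by
  refine isIntGrading_component fun a b h => ?_
  cases h with
  | p_bot => exact ⟨_, ι_mem_freeComponent _ rfl, zero_mem _⟩
  | p_inf => exact ⟨_, ι_mem_freeComponent _ rfl, ι_mul_ι_mem_freeComponent _ _ rfl⟩
  | p_sup => exact ⟨_, ι_mem_freeComponent _ rfl, sub_mem (add_mem (ι_mem_freeComponent _ rfl)
      (ι_mem_freeComponent _ rfl)) (ι_mem_freeComponent _ rfl)⟩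
  | p_mul_s | sStar_mul_p =>
    exact ⟨_, ι_mul_ι_mem_freeComponent _ _ rfl, ι_mul_ι_mem_freeComponent _ _ rfl⟩
  | sStar_mul_s | s_mul_p | p_mul_sStar =>
    exact ⟨_, ι_mul_ι_mem_freeComponent _ _ rfl, ι_mem_freeComponent _ rfl⟩
  | sStar_mul_s_of_ne => exact ⟨_, ι_mul_ι_mem_freeComponent _ _ rfl, zero_mem _⟩
  | p_regular =>
    exact ⟨_, ι_mem_freeComponent _ rfl, sum_mem fun i _ => ι_mul_ι_mem_freeComponent _ _ rfl⟩

/-! ### Boundary paths -/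

/-- `η` is a prime filter of `𝓑` or empty. -/
structure IsState (η : 𝓑 → Prop) : Prop where
  not_bot : ¬ η ⊥
  inf_iff : ∀ A B, η (A ⊓ B) ↔ η A ∧ η B
  sup_iff : ∀ A B, η (A ⊔ B) ↔ η A ∨ η B

open Order in
/-- A set of elements that is closed under finite meets and avoids `⊥` is contained in a prime
filter. -/
theorem exists_isState {G : 𝓑 → Prop} (hne : ∃ A, G A) (hinf : ∀ A B, G A → G B → G (A ⊓ B))
    (hbot : ¬ G ⊥) : ∃ η, IsState η ∧ ∀ A, G A → η A := by
  let F : PFilter 𝓑 := IsPFilter.toPFilter (F := {A | ∃ B, G B ∧ B ≤ A}) (by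
    refine IsPFilter.of_def ?_ ?_ ?_
    · obtain ⟨A, hA⟩ := hne
      exact ⟨A, A, hA, le_rfl⟩
    · rintro A ⟨A', hA, hA'⟩ B ⟨B', hB, hB'⟩
      exact ⟨A ⊓ B, ⟨A' ⊓ B', hinf _ _ hA hB, inf_le_inf hA' hB'⟩, inf_le_left, inf_le_right⟩
    · rintro A B hAB ⟨C, hC, hCA⟩
      exact ⟨C, hC, hCA.trans hAB⟩)
  have hd : Disjoint (F : Set 𝓑) ((Ideal.principal (⊥ : 𝓑) : Ideal 𝓑) : Set 𝓑) := by
    rw [Set.disjoint_left]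
    rintro A ⟨B, hB, hBA⟩ hA
    exact hbot (le_bot_iff.1 (hBA.trans (Ideal.mem_principal.1 hA)) ▸ hB)
  obtain ⟨J, hJ, -, hFJ⟩ := DistribLattice.prime_ideal_of_disjoint_filter_ideal hd
  rw [Set.disjoint_left] at hFJ
  refine ⟨fun A => A ∉ J, ⟨fun h => h J.bot_mem, fun A B => ?_, fun A B => ?_⟩, fun A hA =>
    hFJ ⟨A, hA, le_rfl⟩⟩
  · constructor
    · exact fun h => ⟨fun h' => h (J.lower inf_le_left h'), fun h' => h (J.lower inf_le_right h')⟩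
    · rintro ⟨h1, h2⟩ h
      exact (hJ.mem_or_mem h).elim h1 h2
  · rw [Ideal.sup_mem_iff]
    tauto

/-- A state that contains a regular element is the preimage of another state under some `θ_α`. -/
theorem exists_next_state (D : GenBooleanDynSystem 𝓑 Λ) {η : 𝓑 → Prop} (hη : IsState η) {A : 𝓑}
    (hA : D.IsRegular A) (hηA : η A) : ∃ α η', IsState η' ∧ (∀ B, η B ↔ η' (D.θ α B)) ∧
      ∃ B ∈ D.idl α, η' B := by
  have hne : ∀ {C}, η C → C ≠ ⊥ := by
    rintro _ h rfl
    exact hη.not_bot h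
  -- Compactness: if every `θ_α` killed some `C_α` in `η`, then `A` intersected with the finitely
  -- many `C_α`, `α ∈ Δ_A`, would be a non-empty `E ⊆ A` with `Δ_E = ∅`, against regularity.
  obtain ⟨α, hα⟩ : ∃ α, ∀ C, η C → D.θ α C ≠ ⊥ := by
    by_contra! hcon
    choose C hC hθ using hcon
    have hfin := (hA A le_rfl (hne hηA)).2
    have : ∃ E, η E ∧ E ≤ A ∧ ∀ α ∈ hfin.toFinset, E ≤ C α := by
      induction hfin.toFinset using Finset.cons_induction with
      | empty => exact ⟨A, hηA, le_rfl, by simp⟩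
      | cons α F hα ih =>
        obtain ⟨E, hE, hEA, h⟩ := ih
        refine ⟨E ⊓ C α, (hη.inf_iff _ _).2 ⟨hE, hC α⟩, inf_le_left.trans hEA, ?_⟩
        intro β hβ
        rcases Finset.mem_cons.1 hβ with rfl | hβ
        · exact inf_le_right
        · exact inf_le_left.trans (h β hβ)
    obtain ⟨E, hE, hEA, h⟩ := this
    obtain ⟨α, hα⟩ := (hA E hEA (hne hE)).1
    have hαA : α ∈ D.Δ A := fun h' => hα (le_bot_iff.1 (h' ▸ OrderHomClass.mono (D.θ α) hEA))
    exact hα (le_bot_iff.1 (hθ α ▸ OrderHomClass.mono (D.θ α) (h α (by simpa using hαA))))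
  -- For this `α` the image of `η` under `θ_α` is closed under meets and avoids `⊥`, so it extends
  -- to a prime filter.
  obtain ⟨η', hη', h⟩ := exists_isState (G := fun B => ∃ C, η C ∧ B = D.θ α C)
    ⟨_, A, hηA, rfl⟩ (by
      rintro _ _ ⟨C, hC, rfl⟩ ⟨C', hC', rfl⟩
      exact ⟨C ⊓ C', (hη.inf_iff _ _).2 ⟨hC, hC'⟩, (map_inf _ _ _).symm⟩) (by
      rintro ⟨C, hC, h⟩
      exact hα C hC h.symm)
  refine ⟨α, η', hη', fun B => ⟨fun hB => h _ ⟨B, hB, rfl⟩, fun hB => ?_⟩, D.θ α A,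
    D.mem_idl_of_le _ _ A le_rfl, h _ ⟨A, hηA, rfl⟩⟩
  -- If `B` is not in `η`, then `A \ B` is, and `η'` would contain the disjoint elements `θ_α(B)`
  -- and `θ_α(A \ B)`.
  by_contra hnB
  have hdiff : η (A \ B) := by
    have := hηA
    rw [← sup_inf_sdiff A B, hη.sup_iff, hη.inf_iff] at this
    tauto
  apply hη'.not_bot
  have := (hη'.inf_iff _ _).2 ⟨hB, h _ ⟨_, hdiff, rfl⟩⟩
  rwa [← map_inf, inf_sdiff_self_right, D.map_bot] at this

/-- A path `(η₀, α₁, η₁, α₂, …)` of states and letters, which may end (no letter) only at states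
that contain no regular element. What follows a missing letter is irrelevant. -/
@[ext]
structure BoundaryPath (D : GenBooleanDynSystem 𝓑 Λ) where
  state : ℕ → 𝓑 → Prop
  letter : ℕ → Option Λ
  isState : ∀ n, IsState (state n)
  step : ∀ n α, letter n = some α → (∀ A, state n A ↔ state (n + 1) (D.θ α A)) ∧
    ∃ B ∈ D.idl α, state (n + 1) B
  halt : ∀ n, letter n = none → ∀ A, D.IsRegular A → ¬ state n A

namespace BoundaryPath

variable {D : GenBooleanDynSystem 𝓑 Λ}

/-- Continue with `exists_next_state` as long as the state contains a regular element; otherwise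
record no letter and repeat the state. -/
theorem exists_of_isState {η : 𝓑 → Prop} (hη : IsState η) : ∃ x : D.BoundaryPath, x.state 0 = η := by
  have hnext : ∀ η : {η : 𝓑 → Prop // IsState η}, ∃ y : Option Λ × {η : 𝓑 → Prop // IsState η},
      (∀ α, y.1 = some α → (∀ A, η.1 A ↔ y.2.1 (D.θ α A)) ∧ ∃ B ∈ D.idl α, y.2.1 B) ∧
        (y.1 = none → ∀ A, D.IsRegular A → ¬ η.1 A) := by
    rintro ⟨η, hη⟩
    by_cases h : ∃ A, D.IsRegular A ∧ η A
    · obtain ⟨A, hA, hηA⟩ := h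
      obtain ⟨α, η', hη', h⟩ := D.exists_next_state hη hA hηA
      refine ⟨(some α, ⟨η', hη'⟩), ?_, by simp⟩
      rintro β hβ
      cases hβ
      exact h
    · exact ⟨(none, ⟨η, hη⟩), by simp, fun _ A hA hηA => h ⟨A, hA, hηA⟩⟩
  choose f hf hf' using hnext
  exact ⟨{  state := fun n => ((fun η => (f η).2)^[n] ⟨η, hη⟩).1
            letter := fun n => (f ((fun η => (f η).2)^[n] ⟨η, hη⟩)).1
            isState := fun n => ((fun η => (f η).2)^[n] ⟨η, hη⟩).2
            step := fun n α h => by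
              rw [Function.iterate_succ_apply']
              exact hf _ α h
            halt := fun n h => hf' _ h }, rfl⟩

/-- The path without its first letter. -/
def tail (x : D.BoundaryPath) : D.BoundaryPath where
  state n := x.state (n + 1)
  letter n := x.letter (n + 1)
  isState n := x.isState (n + 1)
  step n := x.step (n + 1)
  halt n := x.halt (n + 1)

/-- The path with a letter added in front. -/
def cons (α : Λ) (x : D.BoundaryPath) (h : ∃ B ∈ D.idl α, x.state 0 B) : D.BoundaryPath where
  -- The preimage of a prime filter under `θ_α` may be empty, which is why empty states are
  -- admitted.
  state n := Nat.casesOn n (fun A => x.state 0 (D.θ α A)) x.state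
  letter n := Nat.casesOn n (some α) x.letter
  isState n := by
    cases n with
    | zero =>
      refine ⟨?_, fun A B => ?_, fun A B => ?_⟩
      · simpa [D.map_bot] using (x.isState 0).not_bot
      · simpa using (x.isState 0).inf_iff _ _
      · simpa using (x.isState 0).sup_iff _ _
    | succ n => exact x.isState n
  step n := by
    cases n with
    | zero =>
      rintro β hβ
      cases hβ
      exact ⟨fun A => Iff.rfl, h⟩
    | succ n => exact x.step n
  halt n := by
    cases n with
    | zero => exact fun h => by cases h
    | succ n => exact x.halt n

@[simp]
theorem tail_cons (α : Λ) (x : D.BoundaryPath) (h) : (cons α x h).tail = x := rfl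

@[simp]
theorem letter_cons (α : Λ) (x : D.BoundaryPath) (h) : (cons α x h).letter 0 = some α := rfl

@[simp]
theorem state_cons (α : Λ) (x : D.BoundaryPath) (h) (A : 𝓑) :
    (cons α x h).state 0 A ↔ x.state 0 (D.θ α A) := Iff.rfl

theorem state_iff {x : D.BoundaryPath} {α : Λ} (h : x.letter 0 = some α) (A : 𝓑) :
    x.state 0 A ↔ x.tail.state 0 (D.θ α A) := (x.step 0 α h).1 A

theorem cons_tail {x : D.BoundaryPath} {α : Λ} (h : x.letter 0 = some α) :
    cons α x.tail (x.step 0 α h).2 = x := by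
  refine BoundaryPath.ext (funext fun n => ?_) (funext fun n => ?_)
  · cases n with
    | zero => exact funext fun A => propext (state_iff h A).symm
    | succ n => rfl
  · cases n with
    | zero => exact h.symm
    | succ n => rfl

variable (R : Type*) [CommRing R] (D)

open scoped Classical in
/-- The action of `p_A` on functions of boundary paths. -/
noncomputable def pOp (A : 𝓑) : Module.End R (D.BoundaryPath → R) where
  toFun f x := if x.state 0 A then f x else 0
  map_add' f g := by ext x; simp only [Pi.add_apply]; split_ifs <;> simp
  map_smul' r f := by ext x; simp

open scoped Classical in
/-- The action of `s_{α,B}` on functions of boundary paths. -/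
noncomputable def sOp (α : Λ) (B : D.idl α) : Module.End R (D.BoundaryPath → R) where
  toFun f x := if x.letter 0 = some α ∧ x.tail.state 0 B then f x.tail else 0
  map_add' f g := by ext x; simp only [Pi.add_apply]; split_ifs <;> simp
  map_smul' r f := by ext x; simp

open scoped Classical in
/-- The action of `s*_{α,B}` on functions of boundary paths. -/
noncomputable def sStarOp (α : Λ) (B : D.idl α) : Module.End R (D.BoundaryPath → R) where
  toFun f x := if h : x.state 0 B then f (cons α x ⟨B, B.2, h⟩) else 0
  map_add' f g := by ext x; simp only [Pi.add_apply]; split_ifs <;> simp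
  map_smul' r f := by ext x; simp

-- At a path starting in `A` only the summand of its first letter survives, and removing and
-- restoring that letter gives the path back. A first letter exists because of `halt`: this is the
-- only relation that uses that condition.
open scoped Classical in
theorem pOp_regular {A : 𝓑} (hA : D.IsRegular A) {F : Finset Λ} (hF : (F : Set Λ) = D.Δ A) :
    pOp D R A = ∑ α ∈ F, sOp D R α (D.img α A) * sStarOp D R α (D.img α A) := by
  ext f x
  simp only [LinearMap.sum_apply, Finset.sum_apply, Module.End.mul_apply]
  simp only [pOp, sOp, sStarOp, LinearMap.coe_mk, AddHom.coe_mk]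
  split_ifs with h
  · obtain hl | ⟨α, hα⟩ := (x.letter 0).eq_none_or_eq_some
    · exact absurd h (x.halt 0 hl A hA)
    · have hθ : x.tail.state 0 (D.img α A) := (state_iff hα A).1 h
      have hαF : α ∈ F := by
        rw [← Finset.mem_coe, hF]
        intro h0
        exact (x.tail.isState 0).not_bot (h0 ▸ (state_iff hα A).1 h)
      rw [Finset.sum_eq_single_of_mem α hαF, if_pos ⟨hα, hθ⟩, dif_pos hθ, cons_tail hα]
      intro β _ hβ
      rw [if_neg]
      rintro ⟨h', -⟩
      rw [hα] at h'
      exact hβ (Option.some_injective _ h').symm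
  · refine (Finset.sum_eq_zero fun α _ => if_neg ?_).symm
    rintro ⟨hα, h'⟩
    exact h ((state_iff hα A).2 h')

theorem exists_representation : ∃ φ : D.BooleanAlg R →ₙₐ[R] Module.End R (D.BoundaryPath → R),
    ∀ A, φ (BooleanAlg.p R D A) = pOp D R A := by
  classical
  obtain ⟨φ, hφ, -⟩ := BooleanAlg.exists_lift (D := D) (R := R) (pOp D R) (sOp D R) (sStarOp D R)
    (by ext f x; simp [pOp, (x.isState 0).not_bot])
    (fun A B => by
      ext f x
      simp only [pOp, LinearMap.coe_mk, AddHom.coe_mk, Module.End.mul_apply, (x.isState 0).inf_iff]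
      by_cases h1 : x.state 0 A <;> by_cases h2 : x.state 0 B <;> simp [h1, h2])
    (fun A B => by
      ext f x
      simp only [pOp, LinearMap.coe_mk, AddHom.coe_mk, LinearMap.add_apply, LinearMap.sub_apply,
        Pi.add_apply, Pi.sub_apply, (x.isState 0).inf_iff, (x.isState 0).sup_iff]
      by_cases h1 : x.state 0 A <;> by_cases h2 : x.state 0 B <;> simp [h1, h2])
    (fun A α B => by
      ext f x
      simp only [pOp, sOp, LinearMap.coe_mk, AddHom.coe_mk, Module.End.mul_apply]
      by_cases h : x.letter 0 = some α
      · by_cases h1 : x.tail.state 0 B <;> by_cases h2 : x.tail.state 0 (D.θ α A) <;>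
          simp [h, h1, h2, state_iff h]
      · simp [h])
    (fun A α B => by
      ext f x
      simp only [pOp, sStarOp, LinearMap.coe_mk, AddHom.coe_mk, Module.End.mul_apply, state_cons]
      by_cases h1 : x.state 0 B <;> by_cases h2 : x.state 0 (D.θ α A) <;> simp [h1, h2])
    (fun α B B' => by
      ext f x
      simp only [pOp, sOp, sStarOp, LinearMap.coe_mk, AddHom.coe_mk, Module.End.mul_apply,
        letter_cons, tail_cons, (x.isState 0).inf_iff]
      by_cases h1 : x.state 0 B <;> by_cases h2 : x.state 0 B' <;> simp [h1, h2])
    (fun α α' B B' hne => by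
      ext f x
      simp only [sOp, sStarOp, LinearMap.coe_mk, AddHom.coe_mk, Module.End.mul_apply,
        letter_cons, tail_cons]
      simp [hne])
    (fun α B B' => by
      ext f x
      have hcut : x.tail.state 0 (D.cut B B') ↔ _ := (x.tail.isState 0).inf_iff _ _
      simp only [pOp, sOp, LinearMap.coe_mk, AddHom.coe_mk, Module.End.mul_apply, hcut]
      by_cases h1 : x.tail.state 0 B <;> by_cases h2 : x.tail.state 0 B' <;> simp [h1, h2])
    (fun α B B' => by
      ext f x
      have hcut : x.state 0 (D.cut B B') ↔ _ := (x.isState 0).inf_iff _ _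
      simp only [pOp, sStarOp, LinearMap.coe_mk, AddHom.coe_mk, Module.End.mul_apply, hcut]
      by_cases h1 : x.state 0 B <;> by_cases h2 : x.state 0 B' <;> simp [h1, h2])
    (fun A hA F hF => pOp_regular D R hA hF)
  exact ⟨φ, hφ⟩

end BoundaryPath

/-- The elements `r p_A` are non-zero for `r ≠ 0` and `A ≠ ∅`. -/
theorem BooleanAlg.smul_p_ne_zero {R : Type*} [CommRing R] (D : GenBooleanDynSystem 𝓑 Λ) {r : R}
    (hr : r ≠ 0) {A : 𝓑} (hA : A ≠ ⊥) : r • p R D A ≠ 0 := by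
  obtain ⟨η, hη, h⟩ := exists_isState (G := fun B => B = A) ⟨A, rfl⟩
    (by rintro _ _ rfl rfl; simp) (Ne.symm hA)
  obtain ⟨x, hx⟩ := BoundaryPath.exists_of_isState (D := D) hη
  obtain ⟨φ, hφ⟩ := BoundaryPath.exists_representation D R
  intro h0
  -- Applied to the constant function `1`, the operator of `r p_A` takes the value `r` at a path
  -- whose first state contains `A`.
  have := congrArg (fun T => φ T (fun _ => 1) x) h0
  have hxA : x.state 0 A := hx ▸ h A rfl
  simp [hφ, BoundaryPath.pOp, hxA] at this
  exact hr this

end GenBooleanDynSystem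

/-! ### The spans of the `p_A`, `s_{α,B}`, `s*_{α,B}` and their products -/

theorem Submodule.mul_mem_of_mem_span {R A : Type*} [CommRing R] [NonUnitalRing A] [Module R A]
    [IsScalarTower R A A] [SMulCommClass R A A] {s t : Set A} {N : Submodule R A}
    (h : ∀ a ∈ s, ∀ b ∈ t, a * b ∈ N) {a b : A} (ha : a ∈ span R s) (hb : b ∈ span R t) :
    a * b ∈ N := by
  induction ha using Submodule.span_induction with
  | zero => simp
  | add x y _ _ hx hy =>
    rw [add_mul]
    exact N.add_mem hx hy
  | smul r x _ hx =>
    rw [smul_mul_assoc]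
    exact N.smul_mem r hx
  | mem a ha =>
    induction hb using Submodule.span_induction with
    | zero => simp
    | add x y _ _ hx hy =>
      rw [mul_add]
      exact N.add_mem hx hy
    | smul r x _ hx =>
      rw [mul_smul_comm]
      exact N.smul_mem r hx
    | mem b hb => exact h a ha b hb

namespace GenBooleanDynSystem

variable {𝓑 : Type*} [GeneralizedBooleanAlgebra 𝓑] {Λ : Type*}

namespace BooleanAlg

section Spans

variable (R : Type*) [CommRing R] (D : GenBooleanDynSystem 𝓑 Λ)

/-- The `R`-span of the elements `p_A`. -/
noncomputable def pSpan : Submodule R (D.BooleanAlg R) :=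
  Submodule.span R (Set.range (p R D))

/-- The `R`-span of the elements `s_{α,B}`. -/
noncomputable def sSpan : Submodule R (D.BooleanAlg R) :=
  Submodule.span R {x | ∃ α B, x = s R D α B}

/-- The `R`-span of the elements `s*_{α,B}`. -/
noncomputable def sStarSpan : Submodule R (D.BooleanAlg R) :=
  Submodule.span R {x | ∃ α B, x = sStar R D α B}

variable {R D}

theorem p_mem (A : 𝓑) : p R D A ∈ pSpan R D := Submodule.subset_span ⟨A, rfl⟩

theorem s_mem (α : Λ) (B : D.idl α) : s R D α B ∈ sSpan R D := Submodule.subset_span ⟨α, B, rfl⟩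

theorem sStar_mem (α : Λ) (B : D.idl α) : sStar R D α B ∈ sStarSpan R D :=
  Submodule.subset_span ⟨α, B, rfl⟩

theorem p_mul_s' (A : 𝓑) (α : Λ) (B : D.idl α) :
    p R D A * s R D α B = s R D α (D.cut B (D.θ α A)) := by
  rw [p_mul_s, s_mul_p]

theorem sStar_mul_p' (A : 𝓑) (α : Λ) (B : D.idl α) :
    sStar R D α B * p R D A = sStar R D α (D.cut B (D.θ α A)) := by
  rw [sStar_mul_p, p_mul_sStar]

variable {a b : D.BooleanAlg R}

theorem mul_mem_pSpan (ha : a ∈ pSpan R D) (hb : b ∈ pSpan R D) : a * b ∈ pSpan R D := by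
  refine Submodule.mul_mem_of_mem_span ?_ ha hb
  rintro _ ⟨A, rfl⟩ _ ⟨B, rfl⟩
  rw [← p_inf]
  exact p_mem _

theorem pSpan_mul_sSpan (ha : a ∈ pSpan R D) (hb : b ∈ sSpan R D) : a * b ∈ sSpan R D := by
  refine Submodule.mul_mem_of_mem_span ?_ ha hb
  rintro _ ⟨A, rfl⟩ _ ⟨α, B, rfl⟩
  rw [p_mul_s']
  exact s_mem _ _

theorem sSpan_mul_pSpan (ha : a ∈ sSpan R D) (hb : b ∈ pSpan R D) : a * b ∈ sSpan R D := by
  refine Submodule.mul_mem_of_mem_span ?_ ha hb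
  rintro _ ⟨α, B, rfl⟩ _ ⟨A, rfl⟩
  rw [s_mul_p]
  exact s_mem _ _

theorem pSpan_mul_sStarSpan (ha : a ∈ pSpan R D) (hb : b ∈ sStarSpan R D) :
    a * b ∈ sStarSpan R D := by
  refine Submodule.mul_mem_of_mem_span ?_ ha hb
  rintro _ ⟨A, rfl⟩ _ ⟨α, B, rfl⟩
  rw [p_mul_sStar]
  exact sStar_mem _ _

theorem sStarSpan_mul_pSpan (ha : a ∈ sStarSpan R D) (hb : b ∈ pSpan R D) :
    a * b ∈ sStarSpan R D := by
  refine Submodule.mul_mem_of_mem_span ?_ ha hb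
  rintro _ ⟨α, B, rfl⟩ _ ⟨A, rfl⟩
  rw [sStar_mul_p']
  exact sStar_mem _ _

theorem sStarSpan_mul_sSpan (ha : a ∈ sStarSpan R D) (hb : b ∈ sSpan R D) :
    a * b ∈ pSpan R D := by
  refine Submodule.mul_mem_of_mem_span ?_ ha hb
  rintro _ ⟨α, B, rfl⟩ _ ⟨α', B', rfl⟩
  by_cases h : α = α'
  · subst h
    rw [sStar_mul_s]
    exact p_mem _
  · rw [sStar_mul_s_of_ne R D h]
    exact zero_mem _

end Spans

/-! ### The system -/

variable (R : Type*) [CommRing R] (D : GenBooleanDynSystem 𝓑 Λ)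

/-- The subring of `L_R(𝓑, Λ, θ, 𝓘)` spanned by the elements `r p_A`. -/
noncomputable def diag : NonUnitalSubring (D.BooleanAlg R) :=
  { (pSpan R D).toAddSubgroup with mul_mem' := mul_mem_pSpan }

variable {R D} in
theorem mem_diag {a : D.BooleanAlg R} : a ∈ diag R D ↔ a ∈ pSpan R D := Iff.rfl

/-- A subgroup of a ring that is stable under multiplication by the elements of a subring from
both sides is a bimodule over the subring. -/
@[reducible]
def _root_.NUBimodule.ofMul {A : Type*} [NonUnitalRing A] (S : NonUnitalSubring A)
    {R : Type*} [Ring R] [Module R A] (M : Submodule R A) (hl : ∀ s ∈ S, ∀ m ∈ M, s * m ∈ M)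
    (hr : ∀ s ∈ S, ∀ m ∈ M, m * s ∈ M) : NUBimodule S M where
  lact := AddMonoidHom.mk' (fun s => AddMonoidHom.mk' (fun m => ⟨s * m, hl s s.2 m m.2⟩)
    fun _ _ => Subtype.ext (mul_add _ _ _)) fun _ _ => AddMonoidHom.ext fun _ =>
      Subtype.ext (add_mul _ _ _)
  ract := AddMonoidHom.mk' (fun s => AddMonoidHom.mk' (fun m => ⟨m * s, hr s s.2 m m.2⟩)
    fun _ _ => Subtype.ext (add_mul _ _ _)) fun _ _ => AddMonoidHom.ext fun _ =>
      Subtype.ext (mul_add _ _ _)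
  mul_lact _ _ _ := Subtype.ext (mul_assoc _ _ _)
  mul_ract _ _ _ := Subtype.ext (mul_assoc _ _ _).symm
  lact_ract _ _ _ := Subtype.ext (mul_assoc _ _ _).symm

noncomputable instance : NUBimodule (diag R D) (sSpan R D) :=
  NUBimodule.ofMul _ _ (fun _ hs _ hm => pSpan_mul_sSpan hs hm)
    fun _ hs _ hm => sSpan_mul_pSpan hm hs

noncomputable instance : NUBimodule (diag R D) (sStarSpan R D) :=
  NUBimodule.ofMul _ _ (fun _ hs _ hm => pSpan_mul_sStarSpan hs hm)
    fun _ hs _ hm => sStarSpan_mul_pSpan hm hs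

/-- The product as a biadditive map. -/
noncomputable def mulHom : sStarSpan R D →+ sSpan R D →+ diag R D :=
  AddMonoidHom.mk' (fun p => AddMonoidHom.mk' (fun q => ⟨p * q, sStarSpan_mul_sSpan p.2 q.2⟩)
    fun _ _ => Subtype.ext (mul_add _ _ _)) fun _ _ => AddMonoidHom.ext fun _ =>
      Subtype.ext (add_mul _ _ _)

open scoped TensorProduct in
/-- The product as a map on the tensor product over the diagonal subring. -/
noncomputable def mulTensor : NUTensor (diag R D) (sStarSpan R D) (sSpan R D) →+ diag R D :=
  QuotientAddGroup.lift _ (TensorProduct.liftAddHom (R := ℤ) (mulHom R D) fun r p q => by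
    simp) (by
    rw [AddSubgroup.closure_le]
    rintro _ ⟨p, s, q, rfl⟩
    rw [SetLike.mem_coe, AddMonoidHom.mem_ker, map_sub, TensorProduct.liftAddHom_tmul,
      TensorProduct.liftAddHom_tmul, sub_eq_zero]
    exact Subtype.ext (mul_assoc _ _ _))

/-- The system of the spans of the `s*_{α,B}` and of the `s_{α,B}` over the span of the `p_A`, all
operations being given by multiplication in `L_R(𝓑, Λ, θ, 𝓘)`. -/
noncomputable def system : RingSystem (diag R D) where
  P := sStarSpan R D
  Q := sSpan R D
  ψ := mulTensor R D
  ψ_lact _ _ _ := Subtype.ext (mul_assoc _ _ _)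
  ψ_ract _ _ _ := Subtype.ext (mul_assoc _ _ _).symm

variable {R D}

/-- An element of the bimodule `Q` of the system as an element of the algebra. -/
noncomputable def coeQ (q : (system R D).Q) : D.BooleanAlg R := Subtype.val (p := (· ∈ sSpan R D)) q

/-- An element of the bimodule `P` of the system as an element of the algebra. -/
noncomputable def coeP (p : (system R D).P) : D.BooleanAlg R :=
  Subtype.val (p := (· ∈ sStarSpan R D)) p

theorem coeQ_mem (q : (system R D).Q) : coeQ q ∈ sSpan R D := q.2

theorem coeP_mem (p : (system R D).P) : coeP p ∈ sStarSpan R D := p.2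

theorem coeQ_injective : Function.Injective (coeQ (R := R) (D := D)) := Subtype.val_injective

theorem coeP_injective : Function.Injective (coeP (R := R) (D := D)) := Subtype.val_injective

/-- An element of `sSpan` as an element of the bimodule `Q`. -/
noncomputable def mkQ (q : D.BooleanAlg R) (h : q ∈ sSpan R D) : (system R D).Q := ⟨q, h⟩

/-- An element of `sStarSpan` as an element of the bimodule `P`. -/
noncomputable def mkP (p : D.BooleanAlg R) (h : p ∈ sStarSpan R D) : (system R D).P := ⟨p, h⟩

@[simp]
theorem coeQ_mkQ (q : D.BooleanAlg R) (h) : coeQ (mkQ q h) = q := rfl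

@[simp]
theorem coeP_mkP (p : D.BooleanAlg R) (h) : coeP (mkP p h) = p := rfl

theorem coeQ_add (q q' : (system R D).Q) : coeQ (q + q') = coeQ q + coeQ q' := rfl

theorem coeP_add (p p' : (system R D).P) : coeP (p + p') = coeP p + coeP p' := rfl

theorem coeQ_zero : coeQ (0 : (system R D).Q) = 0 := rfl

theorem coeP_zero : coeP (0 : (system R D).P) = 0 := rfl

theorem coeQ_lact (t : diag R D) (q : (system R D).Q) :
    coeQ (NUBimodule.lact t q) = t * coeQ q := rfl

theorem coeQ_ract (t : diag R D) (q : (system R D).Q) :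
    coeQ (NUBimodule.ract t q) = coeQ q * t := rfl

theorem coeP_lact (t : diag R D) (q : (system R D).P) :
    coeP (NUBimodule.lact t q) = t * coeP q := rfl

theorem coeP_ract (t : diag R D) (q : (system R D).P) :
    coeP (NUBimodule.ract t q) = coeP q * t := rfl

theorem coe_pair (p : (system R D).P) (q : (system R D).Q) :
    ((system R D).pair p q : D.BooleanAlg R) = coeP p * coeQ q := rfl

theorem coeQ_sum {ι : Type*} (F : Finset ι) (f : ι → (system R D).Q) :
    coeQ (∑ i ∈ F, f i) = ∑ i ∈ F, coeQ (f i) :=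
  map_sum (⟨⟨coeQ, coeQ_zero⟩, coeQ_add⟩ : (system R D).Q →+ D.BooleanAlg R) f F

theorem coeP_sum {ι : Type*} (F : Finset ι) (f : ι → (system R D).P) :
    coeP (∑ i ∈ F, f i) = ∑ i ∈ F, coeP (f i) :=
  map_sum (⟨⟨coeP, coeP_zero⟩, coeP_add⟩ : (system R D).P →+ D.BooleanAlg R) f F

/-- By associativity `q (p x) = (q p) x`, so operators of finite rank on `Q` are left
multiplications by elements of `qpSpan`; on `P` they are right multiplications by the same elements.
-/
theorem coeQ_finRankQ {n : ℕ} (q : Fin n → (system R D).Q) (p : Fin n → (system R D).P)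
    (x : (system R D).Q) :
    coeQ ((system R D).finRankQ q p x) = (∑ i, coeQ (q i) * coeP (p i)) * coeQ x := by
  simp only [RingSystem.finRankQ, coeQ_sum, coeQ_ract, coe_pair, Finset.sum_mul, mul_assoc]

theorem coeP_finRankP {n : ℕ} (q : Fin n → (system R D).Q) (p : Fin n → (system R D).P)
    (y : (system R D).P) :
    coeP ((system R D).finRankP q p y) = coeP y * ∑ i, coeQ (q i) * coeP (p i) := by
  simp only [RingSystem.finRankP, coeP_sum, coeP_lact, coe_pair, Finset.mul_sum, mul_assoc]

/-! ### Local units -/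

theorem s_mul_p_of_le {α : Λ} {B : D.idl α} {A : 𝓑} (h : (B : 𝓑) ≤ A) :
    s R D α B * p R D A = s R D α B := by
  rw [s_mul_p]
  exact congrArg _ (Subtype.ext (inf_eq_left.2 h))

theorem p_mul_sStar_of_le {α : Λ} {B : D.idl α} {A : 𝓑} (h : (B : 𝓑) ≤ A) :
    p R D A * sStar R D α B = sStar R D α B := by
  rw [p_mul_sStar]
  exact congrArg _ (Subtype.ext (inf_eq_left.2 h))

open Filter

theorem eventually_mul_p {q : D.BooleanAlg R} (hq : q ∈ sSpan R D) :
    ∀ᶠ A in atTop, q * p R D A = q := by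
  induction hq using Submodule.span_induction with
  | zero => simp
  | add x y _ _ hx hy =>
    filter_upwards [hx, hy] with A h1 h2
    rw [add_mul, h1, h2]
  | smul r x _ hx =>
    filter_upwards [hx] with A h
    rw [smul_mul_assoc, h]
  | mem x hx =>
    obtain ⟨α, B, rfl⟩ := hx
    filter_upwards [eventually_ge_atTop (B : 𝓑)] with A h
    exact s_mul_p_of_le h

theorem eventually_p_mul {y : D.BooleanAlg R} (hy : y ∈ sStarSpan R D) :
    ∀ᶠ A in atTop, p R D A * y = y := by
  induction hy using Submodule.span_induction with
  | zero => simp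
  | add x y _ _ hx hy =>
    filter_upwards [hx, hy] with A h1 h2
    rw [mul_add, h1, h2]
  | smul r x _ hx =>
    filter_upwards [hx] with A h
    rw [mul_smul_comm, h]
  | mem x hx =>
    obtain ⟨α, B, rfl⟩ := hx
    filter_upwards [eventually_ge_atTop (B : 𝓑)] with A h
    exact p_mul_sStar_of_le h

/-- Index set of the local units. Directedness makes `atTop` a proper filter, so that finitely many
elements have a common local unit. -/
instance : IsDirectedOrder (Finset Λ × (∀ α, D.idl α)) := by
  classical
  exact ⟨fun i j => ⟨(i.1 ∪ j.1, fun α => ⟨i.2 α ⊔ j.2 α, (D.idl α).sup_mem (i.2 α).2 (j.2 α).2⟩),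
    ⟨Finset.subset_union_left, fun _ => le_sup_left (α := 𝓑)⟩,
    ⟨Finset.subset_union_right, fun _ => le_sup_right (α := 𝓑)⟩⟩⟩

/-- The sums of the `s_{α,B_α} s*_{α,B_α}` over a finite set of letters. -/
noncomputable def localUnit (i : Finset Λ × (∀ α, D.idl α)) : D.BooleanAlg R :=
  ∑ α ∈ i.1, s R D α (i.2 α) * sStar R D α (i.2 α)

instance : Nonempty (Finset Λ × (∀ α, D.idl α)) :=
  ⟨(∅, fun α => ⟨⊥, (D.idl α).bot_mem⟩)⟩

theorem eventually_mem_and_le (α : Λ) (B : D.idl α) :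
    ∀ᶠ i : Finset Λ × (∀ α, D.idl α) in atTop, α ∈ i.1 ∧ (B : 𝓑) ≤ i.2 α := by
  classical
  refine eventually_atTop.2 ⟨({α}, Function.update (fun α => ⟨⊥, (D.idl α).bot_mem⟩) α B), ?_⟩
  rintro ⟨F, b⟩ ⟨h1, h2⟩
  refine ⟨h1 (Finset.mem_singleton_self α), ?_⟩
  simpa using h2 α

/-- For `B ⊆ B_α`, the summand of `α` fixes `s_{α,B}`, and the other summands kill it by
orthogonality of distinct letters. -/
theorem eventually_localUnit_mul {q : D.BooleanAlg R} (hq : q ∈ sSpan R D) :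
    ∀ᶠ i in atTop, localUnit (D := D) i * q = q := by
  induction hq using Submodule.span_induction with
  | zero => simp
  | add x y _ _ hx hy =>
    filter_upwards [hx, hy] with A h1 h2
    rw [mul_add, h1, h2]
  | smul r x _ hx =>
    filter_upwards [hx] with A h
    rw [mul_smul_comm, h]
  | mem x hx =>
    obtain ⟨α, B, rfl⟩ := hx
    filter_upwards [eventually_mem_and_le α B] with i hi
    rw [localUnit, Finset.sum_mul, Finset.sum_eq_single_of_mem α hi.1]
    · rw [mul_assoc, sStar_mul_s, inf_eq_right.2 hi.2, s_mul_p]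
      exact congrArg _ (Subtype.ext (inf_eq_right.2 hi.2))
    · intro β _ hβ
      rw [mul_assoc, sStar_mul_s_of_ne R D hβ, mul_zero]

theorem eventually_mul_localUnit {y : D.BooleanAlg R} (hy : y ∈ sStarSpan R D) :
    ∀ᶠ i in atTop, y * localUnit (D := D) i = y := by
  induction hy using Submodule.span_induction with
  | zero => simp
  | add x y _ _ hx hy =>
    filter_upwards [hx, hy] with A h1 h2
    rw [add_mul, h1, h2]
  | smul r x _ hx =>
    filter_upwards [hx] with A h
    rw [smul_mul_assoc, h]
  | mem x hx =>
    obtain ⟨α, B, rfl⟩ := hx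
    filter_upwards [eventually_mem_and_le α B] with i hi
    rw [localUnit, Finset.mul_sum, Finset.sum_eq_single_of_mem α hi.1]
    · rw [← mul_assoc, sStar_mul_s, inf_eq_left.2 hi.2, p_mul_sStar]
      exact congrArg _ (Subtype.ext (inf_eq_right.2 hi.2))
    · intro β _ hβ
      rw [← mul_assoc, sStar_mul_s_of_ne R D hβ.symm, zero_mul]

variable (R D) in
/-- The additive group of finite sums of products of elements of `sSpan` and `sStarSpan`. -/
noncomputable def qpSpan : AddSubgroup (D.BooleanAlg R) :=
  AddSubgroup.closure {z | ∃ q ∈ sSpan R D, ∃ p ∈ sStarSpan R D, z = q * p}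

theorem mul_mem_qpSpan {q y : D.BooleanAlg R} (hq : q ∈ sSpan R D) (hy : y ∈ sStarSpan R D) :
    q * y ∈ qpSpan R D := AddSubgroup.subset_closure ⟨q, hq, y, hy, rfl⟩

theorem localUnit_mem (i : Finset Λ × (∀ α, D.idl α)) : localUnit i ∈ qpSpan R D :=
  sum_mem fun _ _ => mul_mem_qpSpan (s_mem _ _) (sStar_mem _ _)

theorem exists_sum_of_mem_qpSpan {z : D.BooleanAlg R} (hz : z ∈ qpSpan R D) :
    ∃ (n : ℕ) (q : Fin n → (system R D).Q) (p : Fin n → (system R D).P),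
      z = ∑ i, coeQ (q i) * coeP (p i) := by
  induction hz using AddSubgroup.closure_induction with
  | mem z hz =>
    obtain ⟨q, hq, y, hy, rfl⟩ := hz
    exact ⟨1, fun _ => mkQ q hq, fun _ => mkP y hy, by simp⟩
  | zero => exact ⟨0, Fin.elim0, Fin.elim0, by simp⟩
  | add x y _ _ hx hy =>
    obtain ⟨m, q, p, rfl⟩ := hx
    obtain ⟨n, q', p', rfl⟩ := hy
    exact ⟨m + n, Fin.append q q', Fin.append p p', by simp [Fin.sum_univ_add]⟩
  | neg x _ hx =>
    obtain ⟨m, q, p, rfl⟩ := hx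
    -- The sign is absorbed in the factors from `Q`.
    refine ⟨m, fun i => mkQ (-coeQ (q i)) (neg_mem (coeQ_mem _)), p, by simp⟩

theorem sum_mem_qpSpan {n : ℕ} (q : Fin n → (system R D).Q) (p : Fin n → (system R D).P) :
    ∑ i, coeQ (q i) * coeP (p i) ∈ qpSpan R D :=
  sum_mem fun _ _ => mul_mem_qpSpan (coeQ_mem _) (coeP_mem _)

theorem pSpan_mul_qpSpan {a z : D.BooleanAlg R} (ha : a ∈ pSpan R D) (hz : z ∈ qpSpan R D) :
    a * z ∈ qpSpan R D := by
  induction hz using AddSubgroup.closure_induction with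
  | mem z hz =>
    obtain ⟨q, hq, y, hy, rfl⟩ := hz
    rw [← mul_assoc]
    exact mul_mem_qpSpan (pSpan_mul_sSpan ha hq) hy
  | zero => simp
  | add x y _ _ hx hy =>
    rw [mul_add]
    exact add_mem hx hy
  | neg x _ hx =>
    rw [mul_neg]
    exact neg_mem hx

theorem qpSpan_mul_pSpan {a z : D.BooleanAlg R} (ha : a ∈ pSpan R D) (hz : z ∈ qpSpan R D) :
    z * a ∈ qpSpan R D := by
  induction hz using AddSubgroup.closure_induction with
  | mem z hz =>
    obtain ⟨q, hq, y, hy, rfl⟩ := hz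
    rw [mul_assoc]
    exact mul_mem_qpSpan hq (sStarSpan_mul_pSpan hy ha)
  | zero => simp
  | add x y _ _ hx hy =>
    rw [add_mul]
    exact add_mem hx hy
  | neg x _ hx =>
    rw [neg_mul]
    exact neg_mem hx

theorem smul_mem_qpSpan (r : R) {z : D.BooleanAlg R} (hz : z ∈ qpSpan R D) :
    r • z ∈ qpSpan R D := by
  induction hz using AddSubgroup.closure_induction with
  | mem z hz =>
    obtain ⟨q, hq, y, hy, rfl⟩ := hz
    rw [← smul_mul_assoc]
    exact mul_mem_qpSpan (Submodule.smul_mem _ r hq) hy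
  | zero => simp
  | add x y _ _ hx hy =>
    rw [smul_add]
    exact add_mem hx hy
  | neg x _ hx =>
    rw [smul_neg]
    exact neg_mem hx

theorem eventually_mul_localUnit_of_mem_qpSpan {z : D.BooleanAlg R} (hz : z ∈ qpSpan R D) :
    ∀ᶠ i in atTop, z * localUnit (D := D) i = z := by
  induction hz using AddSubgroup.closure_induction with
  | mem z hz =>
    obtain ⟨q, hq, y, hy, rfl⟩ := hz
    filter_upwards [eventually_mul_localUnit hy] with i hi
    rw [mul_assoc, hi]
  | zero => simp
  | add x y _ _ hx hy =>
    filter_upwards [hx, hy] with i h1 h2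
    rw [add_mul, h1, h2]
  | neg x _ hx =>
    filter_upwards [hx] with i h
    rw [neg_mul, h]

/-- An element of `qpSpan` that annihilates `sSpan` is zero. -/
theorem eq_zero_of_mem_qpSpan {z : D.BooleanAlg R} (hz : z ∈ qpSpan R D)
    (h : ∀ q ∈ sSpan R D, z * q = 0) : z = 0 := by
  -- Here `z = z u` with a local unit `u = ∑ s s*`, and every `z s` vanishes. Both faithfulness of
  -- the ideal and invariance of the inclusion into the algebra rest on this.
  obtain ⟨i, hi⟩ := (eventually_mul_localUnit_of_mem_qpSpan hz).exists
  rw [← hi, localUnit, Finset.mul_sum]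
  exact Finset.sum_eq_zero fun α _ => by rw [← mul_assoc, h _ (s_mem _ _), zero_mul]

/-- Local units lie in `qpSpan`, so they act by finite-rank operators, and one of them fixes any
given finite set. -/
theorem conditionFS : (system R D).ConditionFS := by
  constructor
  · intro F
    obtain ⟨i, hi⟩ := ((eventually_all_finset F).2 fun x _ =>
      eventually_localUnit_mul (coeQ_mem x)).exists
    obtain ⟨n, q, p, h⟩ := exists_sum_of_mem_qpSpan (localUnit_mem (R := R) i)
    refine ⟨n, q, p, fun x hx => coeQ_injective ?_⟩
    rw [coeQ_finRankQ, ← h, hi x hx]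
  · intro F
    obtain ⟨i, hi⟩ := ((eventually_all_finset F).2 fun x _ =>
      eventually_mul_localUnit (coeP_mem x)).exists
    obtain ⟨n, q, p, h⟩ := exists_sum_of_mem_qpSpan (localUnit_mem (R := R) i)
    refine ⟨n, q, p, fun x hx => coeP_injective ?_⟩
    rw [coeP_finRankP, ← h, hi x hx]

/-! ### The Cuntz–Pimsner ideal -/

variable (R D) in
/-- The ideal of the elements of the diagonal that are sums of products of elements of `sSpan`
and `sStarSpan`. -/
noncomputable def cpIdeal : TwoSidedIdeal (diag R D) :=
  .mk' {a | (a : D.BooleanAlg R) ∈ qpSpan R D} (AddSubgroup.zero_mem (qpSpan R D)) (fun h h' => AddSubgroup.add_mem (qpSpan R D) h h')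
    (fun h => AddSubgroup.neg_mem (qpSpan R D) h) (fun {a _} h => pSpan_mul_qpSpan a.2 h)
    (fun {_ b} h => qpSpan_mul_pSpan b.2 h)

theorem mem_cpIdeal {a : diag R D} : a ∈ cpIdeal R D ↔ (a : D.BooleanAlg R) ∈ qpSpan R D := by
  rw [cpIdeal, TwoSidedIdeal.mem_mk', Set.mem_ofPred_eq]

theorem p_mem_qpSpan {A : 𝓑} (hA : D.IsRegular A) : p R D A ∈ qpSpan R D := by
  -- Regularity provides finiteness of `Δ_A` only for `A ≠ ⊥`.
  by_cases h : A = ⊥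
  · rw [h, p_bot]
    exact zero_mem _
  · have hfin := (hA A le_rfl h).2
    rw [p_regular R D hA (F := hfin.toFinset) (by simp)]
    exact sum_mem fun _ _ => mul_mem_qpSpan (s_mem _ _) (sStar_mem _ _)

theorem coe_mul_eq_of_lact_eq {t : diag R D} {n : ℕ} {q : Fin n → (system R D).Q}
    {p : Fin n → (system R D).P} (h : ∀ x, NUBimodule.lact t x = (system R D).finRankQ q p x)
    {x : D.BooleanAlg R} (hx : x ∈ sSpan R D) :
    (t : D.BooleanAlg R) * x = (∑ i, coeQ (q i) * coeP (p i)) * x := by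
  have := congrArg coeQ (h (mkQ x hx))
  rwa [coeQ_lact, coeQ_finRankQ, coeQ_mkQ] at this

/-- The difference of the two sides lies in `qpSpan` and annihilates `sSpan`. This is the invariance
relation for the inclusion of the system into the algebra. -/
theorem coe_eq_sum_of_lact_eq {t : diag R D} (ht : t ∈ cpIdeal R D) {n : ℕ}
    {q : Fin n → (system R D).Q} {p : Fin n → (system R D).P}
    (h : ∀ x, NUBimodule.lact t x = (system R D).finRankQ q p x) :
    (t : D.BooleanAlg R) = ∑ i, coeQ (q i) * coeP (p i) := by
  rw [← sub_eq_zero]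
  refine eq_zero_of_mem_qpSpan (sub_mem (mem_cpIdeal.1 ht) (sum_mem_qpSpan q p)) fun x hx => ?_
  rw [sub_mul, coe_mul_eq_of_lact_eq h hx, sub_self]

theorem isFaithfulIdeal_cpIdeal : (system R D).IsFaithfulIdeal (cpIdeal R D) := by
  intro t ht h
  refine Subtype.ext (eq_zero_of_mem_qpSpan (mem_cpIdeal.1 ht) fun q hq => ?_)
  exact congrArg coeQ (h (mkQ q hq))

theorem isCompatible_cpIdeal : (system R D).IsCompatible (cpIdeal R D) := by
  intro t ht
  obtain ⟨n, q, p, h⟩ := exists_sum_of_mem_qpSpan (mem_cpIdeal.1 ht)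
  refine ⟨n, q, p, fun x => coeQ_injective ?_⟩
  rw [coeQ_lact, coeQ_finRankQ, h]

/-- Right multiplication by some local unit fixes `z`, and a local unit involves only finitely many
letters. Thus an operator of finite rank sees only finitely many letters. -/
theorem eventually_mul_s_eq_zero {z : D.BooleanAlg R} (hz : z ∈ qpSpan R D) :
    ∃ F : Finset Λ, ∀ α ∉ F, ∀ B, z * s R D α B = 0 := by
  obtain ⟨i, hi⟩ := (eventually_mul_localUnit_of_mem_qpSpan hz).exists
  refine ⟨i.1, fun α hα B => ?_⟩
  rw [← hi, mul_assoc, localUnit, Finset.sum_mul, Finset.sum_eq_zero, mul_zero]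
  intro β hβ
  rw [mul_assoc, sStar_mul_s_of_ne R D (by rintro rfl; exact hα hβ), mul_zero]

/-- In a faithful compatible ideal, `r p_A` occurs only for regular `A`. -/
theorem isRegular_of_smul_p_mem {K : TwoSidedIdeal (diag R D)}
    (hK : (system R D).IsFaithfulIdeal K) (hK' : (system R D).IsCompatible K) {r : R} (hr : r ≠ 0)
    {A : 𝓑} {a : diag R D} (ha : (a : D.BooleanAlg R) = r • p R D A) (haK : a ∈ K) :
    D.IsRegular A := by
  intro B hBA hB
  -- Multiplication by `p_B` puts the non-zero element `r p_B` into `K` for every non-empty `B ⊆ A`.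
  set b : diag R D := ⟨p R D B, p_mem B⟩ * a with hb
  have hbB : (b : D.BooleanAlg R) = r • p R D B := by
    change p R D B * (a : D.BooleanAlg R) = _
    rw [ha, mul_smul_comm, ← p_inf, inf_eq_left.2 hBA]
  have hbK : b ∈ K := K.mul_mem_left _ _ haK
  have hb0 : b ≠ 0 := by
    intro h
    apply smul_p_ne_zero D hr hB
    rw [← hbB, h]
    rfl
  have hmul : ∀ α C, (b : D.BooleanAlg R) * s R D α C = r • s R D α (D.cut C (D.θ α B)) := by
    intro α C
    rw [hbB, smul_mul_assoc, p_mul_s']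
  constructor
  -- If `Δ_B` were empty, `r p_B` would annihilate `Q`, contrary to faithfulness.
  · by_contra hΔ
    rw [Set.not_nonempty_iff_eq_empty] at hΔ
    refine hb0 (hK b hbK fun x => coeQ_injective ?_)
    rw [coeQ_lact, coeQ_zero]
    refine Submodule.span_induction (p := fun x _ => (b : D.BooleanAlg R) * x = 0) ?_ ?_ ?_ ?_
      (coeQ_mem x)
    · rintro _ ⟨α, C, rfl⟩
      have hα : D.θ α B = ⊥ := by
        by_contra h
        have : α ∈ D.Δ B := h
        rw [hΔ] at this
        exact this
      rw [hbB, smul_mul_assoc, p_mul_s, hα, p_bot, mul_zero, smul_zero]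
    · simp
    · intro x y _ _ hx hy
      rw [mul_add, hx, hy, add_zero]
    · intro r x _ hx
      rw [mul_smul_comm, hx, smul_zero]
  -- By compatibility, `r p_B` kills all `s_{α,C}` with `α` outside a finite set `F`. For `α ∈ Δ_B`
  -- this is impossible with `C = θ_α(B)`, because multiplying on the left by `s*_{α,C}` yields `r
  -- p_{θ_α(B)} ≠ 0`.
  · obtain ⟨n, q, y, h⟩ := hK' b hbK
    obtain ⟨F, hF⟩ := eventually_mul_s_eq_zero (sum_mem_qpSpan q y)
    refine F.finite_toSet.subset fun α hα => ?_
    by_contra hαF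
    have h0 := coe_mul_eq_of_lact_eq h (s_mem α (D.img α B))
    rw [hF α hαF, hbB, smul_mul_assoc, p_mul_s] at h0
    apply smul_p_ne_zero D hr hα
    have := congrArg (sStar R D α (D.img α B) * ·) h0
    simp only [mul_smul_comm, ← mul_assoc, sStar_mul_s, mul_zero] at this
    rwa [← p_inf, show ((D.img α B : D.idl α) : 𝓑) = D.θ α B from rfl, inf_idem, inf_idem] at this

theorem p_eq_add (A B : 𝓑) : p R D B = p R D (B ⊓ A) + p R D (B \ A) := by
  conv_lhs => rw [← sup_inf_sdiff B A, p_sup, inf_inf_sdiff, p_bot, sub_zero]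

/-- The sum of the elements `r p_A` for the pairs `(r, A)` in a list. -/
noncomputable def listSum (D : GenBooleanDynSystem 𝓑 Λ) (l : List (R × 𝓑)) : D.BooleanAlg R :=
  (l.map fun i => i.1 • p R D i.2).sum

theorem p_mul_listSum (A : 𝓑) (l : List (R × 𝓑)) :
    p R D A * listSum D l = listSum D (l.map fun i => (i.1, i.2 ⊓ A)) := by
  induction l with
  | nil => simp [listSum]
  | cons i l ih =>
    simp only [listSum, List.map_cons, List.sum_cons, mul_add] at ih ⊢
    rw [ih, mul_smul_comm, ← p_inf, inf_comm]

theorem listSum_eq_add (A : 𝓑) (l : List (R × 𝓑)) :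
    listSum D l = p R D A * listSum D l + listSum D (l.map fun i => (i.1, i.2 \ A)) := by
  rw [p_mul_listSum]
  induction l with
  | nil => simp [listSum]
  | cons i l ih =>
    simp only [listSum, List.map_cons, List.sum_cons] at ih ⊢
    rw [ih, p_eq_add A i.2, smul_add]
    abel

/-- Induction over disjoint sums of elements `r p_A`. -/
theorem pSpan_induction {motive : D.BooleanAlg R → Prop} (smul_p : ∀ (r : R) A, motive (r • p R D A))
    (add : ∀ A x y, p R D A * x = x → p R D A * y = 0 → motive x → motive y → motive (x + y))
    {a : D.BooleanAlg R} (ha : a ∈ pSpan R D) : motive a := by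
  -- The leading term `r p_C` with `C` above all other sets drives the induction on the length.
  -- Cutting along the first listed `A`, the part inside `A` has leading term `(r + t) p_A`, the
  -- part outside has `r p_{C \ A}`, and both lists are one entry shorter.
  have key : ∀ (n : ℕ) (l : List (R × 𝓑)), l.length = n → ∀ (C : 𝓑) (r : R), (∀ i ∈ l, i.2 ≤ C) →
      motive (r • p R D C + listSum D l) := by
    intro n
    induction n with
    | zero =>
      intro l hl C r _
      rw [List.length_eq_zero_iff] at hl
      subst hl
      simpa [listSum] using smul_p r C
    | succ n ih =>
      intro l hl C r hC
      obtain ⟨⟨t, A⟩, l, rfl⟩ := List.exists_cons_of_length_eq_add_one hl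
      have hl' : l.length = n := by simpa using hl
      have hA : A ≤ C := hC (t, A) (by simp)
      have hx := ih (l.map fun i => (i.1, i.2 ⊓ A)) (by simpa using hl') A (r + t) (by
        intro i hi
        obtain ⟨j, -, rfl⟩ := List.mem_map.1 hi
        exact inf_le_right)
      have hy := ih (l.map fun i => (i.1, i.2 \ A)) (by simpa using hl') (C \ A) r (by
        intro i hi
        obtain ⟨j, hj, rfl⟩ := List.mem_map.1 hi
        exact sdiff_le_sdiff_right (hC j (by simp [hj])))
      set z := r • p R D C + listSum D ((t, A) :: l) with hz
      have hpz : p R D A * z =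
          (r + t) • p R D A + listSum D (l.map fun i => (i.1, i.2 ⊓ A)) := by
        rw [hz, mul_add, mul_smul_comm, ← p_inf, inf_eq_left.2 hA, p_mul_listSum]
        simp only [listSum, List.map_cons, List.sum_cons, inf_idem]
        rw [add_smul, add_assoc]
      have hzz : z = p R D A * z + (r • p R D (C \ A) + listSum D (l.map fun i =>
          (i.1, i.2 \ A))) := by
        have h1 := listSum_eq_add (D := D) A ((t, A) :: l)
        have h2 : listSum D (((t, A) :: l).map fun i => (i.1, i.2 \ A)) =
            listSum D (l.map fun i => (i.1, i.2 \ A)) := by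
          simp [listSum, p_bot]
        rw [h2] at h1
        conv_lhs => rw [hz, h1, p_eq_add A C, smul_add]
        rw [hz, mul_add, mul_smul_comm, ← p_inf, inf_comm]
        abel
      rw [hzz]
      have hidem : p R D A * p R D A = p R D A := by rw [← p_inf, inf_idem]
      refine add A _ _ (by rw [← mul_assoc, hidem]) ?_ (hpz ▸ hx) hy
      rw [← sub_eq_iff_eq_add'.2 hzz, mul_sub, ← mul_assoc, hidem, sub_self]
  obtain ⟨l, rfl⟩ : ∃ l, a = listSum D l := by
    induction ha using Submodule.closure_induction with
    | zero => exact ⟨[], rfl⟩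
    | add x y _ _ hx hy =>
      obtain ⟨l, rfl⟩ := hx
      obtain ⟨l', rfl⟩ := hy
      exact ⟨l ++ l', by simp [listSum]⟩
    | smul_mem r x hx =>
      obtain ⟨A, rfl⟩ := hx
      exact ⟨[(r, A)], by simp [listSum]⟩
  obtain ⟨C, hC⟩ : ∃ C, ∀ i ∈ l, i.2 ≤ C := by
    clear key ha
    induction l with
    | nil => exact ⟨⊥, by simp⟩
    | cons i l ih =>
      obtain ⟨C, hC⟩ := ih
      refine ⟨i.2 ⊔ C, ?_⟩
      rintro j hj
      rcases List.mem_cons.1 hj with rfl | hj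
      · exact le_sup_left
      · exact (hC j hj).trans le_sup_right
  -- An arbitrary sum is put in this form with leading coefficient `0` and an upper bound `C` of its
  -- sets.
  simpa using key _ l rfl C 0 hC

/-- For maximality, disjointness is essential: the other ideal is an ideal of a ring and need not be
stable under `R`, but a disjoint piece is extracted by multiplying with `p_A` alone, so it stays in
the ideal. -/
theorem isCPIdeal_cpIdeal : (system R D).IsCPIdeal (cpIdeal R D) := by
  refine ⟨conditionFS, ⟨isFaithfulIdeal_cpIdeal, isCompatible_cpIdeal⟩, ?_⟩
  rintro K ⟨hK, hK'⟩ t ht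
  have key := pSpan_induction (motive := fun a => ∀ h : a ∈ pSpan R D, (⟨a, h⟩ : diag R D) ∈ K →
    a ∈ qpSpan R D) ?_ ?_ t.2 t.2 ht
  · exact mem_cpIdeal.2 key
  · intro r A h hrA
    by_cases hr : r = 0
    · rw [hr, zero_smul]
      exact zero_mem _
    · exact smul_mem_qpSpan r (p_mem_qpSpan (isRegular_of_smul_p_mem hK hK' hr rfl hrA))
  · intro A x y hx hy ihx ihy h hxy
    have hx' : x = p R D A * (x + y) := by rw [mul_add, hx, hy, add_zero]
    have hxS : x ∈ pSpan R D := hx' ▸ mul_mem_pSpan (p_mem A) h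
    have hxK : (⟨x, hxS⟩ : diag R D) ∈ K := by
      have := K.mul_mem_left ⟨p R D A, p_mem A⟩ _ hxy
      convert this using 1
      exact Subtype.ext hx'
    have hyS : y ∈ pSpan R D := by simpa using sub_mem h hxS
    have hyK : (⟨y, hyS⟩ : diag R D) ∈ K := by
      have := K.sub_mem hxy hxK
      convert this using 1
      exact Subtype.ext (add_sub_cancel_left x y).symm
    exact add_mem (ihx hxS hxK) (ihy hyS hyK)

end BooleanAlg

end GenBooleanDynSystem

/-! ### The images of the three spans in the Cuntz–Pimsner ring -/

namespace GenBooleanDynSystem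

variable {𝓑 : Type*} [GeneralizedBooleanAlgebra 𝓑] {Λ : Type*}

namespace BooleanAlg

open RingSystem

variable (R : Type*) [CommRing R] (D : GenBooleanDynSystem 𝓑 Λ)

/-- The Cuntz–Pimsner ring of the system of `L_R(𝓑, Λ, θ, 𝓘)`. -/
abbrev CP : Type _ := (system R D).CPRing (cpIdeal R D)

variable {R D}

/-- The image in the Cuntz–Pimsner ring of an element of the diagonal. -/
noncomputable def ofS (a : D.BooleanAlg R) (h : a ∈ pSpan R D) : CP R D :=
  CPRing.ofS _ _ ⟨a, h⟩

/-- The image in the Cuntz–Pimsner ring of an element of `sSpan`. -/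
noncomputable def ofQ (a : D.BooleanAlg R) (h : a ∈ sSpan R D) : CP R D :=
  CPRing.ofQ _ _ (mkQ a h)

/-- The image in the Cuntz–Pimsner ring of an element of `sStarSpan`. -/
noncomputable def ofP (a : D.BooleanAlg R) (h : a ∈ sStarSpan R D) : CP R D :=
  CPRing.ofP _ _ (mkP a h)

variable {a b : D.BooleanAlg R}

theorem ofS_add (ha : a ∈ pSpan R D) (hb : b ∈ pSpan R D) :
    ofS (a + b) (add_mem ha hb) = ofS a ha + ofS b hb :=
  CPRing.ofS_add (X := system R D) (K := cpIdeal R D) ⟨a, ha⟩ ⟨b, hb⟩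

theorem ofQ_add (ha : a ∈ sSpan R D) (hb : b ∈ sSpan R D) :
    ofQ (a + b) (add_mem ha hb) = ofQ a ha + ofQ b hb := CPRing.ofQ_add (mkQ a ha) (mkQ b hb)

theorem ofP_add (ha : a ∈ sStarSpan R D) (hb : b ∈ sStarSpan R D) :
    ofP (a + b) (add_mem ha hb) = ofP a ha + ofP b hb := CPRing.ofP_add (mkP a ha) (mkP b hb)

theorem ofS_mul_ofS (ha : a ∈ pSpan R D) (hb : b ∈ pSpan R D) :
    ofS a ha * ofS b hb = ofS (a * b) (mul_mem_pSpan ha hb) :=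
  (CPRing.ofS_mul (X := system R D) (K := cpIdeal R D) ⟨a, ha⟩ ⟨b, hb⟩).symm

theorem ofS_mul_ofQ (ha : a ∈ pSpan R D) (hb : b ∈ sSpan R D) :
    ofS a ha * ofQ b hb = ofQ (a * b) (pSpan_mul_sSpan ha hb) :=
  (CPRing.ofQ_lact ⟨a, ha⟩ (mkQ b hb)).symm

theorem ofQ_mul_ofS (ha : a ∈ sSpan R D) (hb : b ∈ pSpan R D) :
    ofQ a ha * ofS b hb = ofQ (a * b) (sSpan_mul_pSpan ha hb) :=
  (CPRing.ofQ_ract ⟨b, hb⟩ (mkQ a ha)).symm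

theorem ofS_mul_ofP (ha : a ∈ pSpan R D) (hb : b ∈ sStarSpan R D) :
    ofS a ha * ofP b hb = ofP (a * b) (pSpan_mul_sStarSpan ha hb) :=
  (CPRing.ofP_lact ⟨a, ha⟩ (mkP b hb)).symm

theorem ofP_mul_ofS (ha : a ∈ sStarSpan R D) (hb : b ∈ pSpan R D) :
    ofP a ha * ofS b hb = ofP (a * b) (sStarSpan_mul_pSpan ha hb) :=
  (CPRing.ofP_ract ⟨b, hb⟩ (mkP a ha)).symm

theorem ofP_mul_ofQ (ha : a ∈ sStarSpan R D) (hb : b ∈ sSpan R D) :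
    ofP a ha * ofQ b hb = ofS (a * b) (sStarSpan_mul_sSpan ha hb) :=
  (CPRing.ofS_pair (mkP a ha) (mkQ b hb)).symm

theorem CP.induction_on {motive : CP R D → Prop} (zero : motive 0)
    (add : ∀ x y, motive x → motive y → motive (x + y)) (neg : ∀ x, motive x → motive (-x))
    (mul : ∀ x y, motive x → motive y → motive (x * y)) (hS : ∀ a h, motive (ofS a h))
    (hQ : ∀ a h, motive (ofQ a h)) (hP : ∀ a h, motive (ofP a h)) (x : CP R D) : motive x :=
  CPRing.induction_on zero add neg mul (fun s => hS s s.2) (fun q => hQ q.1 q.2)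
    (fun p => hP p.1 p.2) x

/-! ### The `R`-module structure of the Cuntz–Pimsner ring -/

/-- The multiplication by a scalar `r` as a map on the Cuntz–Pimsner ring. -/
theorem exists_scale (r : R) : ∃ m : CP R D → CP R D, (∀ x y, m (x + y) = m x + m y) ∧
    (∀ x y, m (x * y) = m x * y) ∧
    (∀ a h, m (ofS a h) = ofS (r • a) (Submodule.smul_mem _ r h)) ∧
    (∀ a h, m (ofQ a h) = ofQ (r • a) (Submodule.smul_mem _ r h)) ∧
    ∀ a h, m (ofP a h) = ofP (r • a) (Submodule.smul_mem _ r h) := by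
  -- Since `M d x * M d' x' = M (d x') (x x')`, a ring homomorphism `x ↦ M (m x) x` amounts to an
  -- additive `m` with `m (x y) = m x * y`. The universal property thus yields `m` as a matrix
  -- entry.
  let M : CP R D → CP R D → Matrix (Fin 2) (Fin 2) (CP R D) := fun d x => !![0, d; 0, x]
  have M_add : ∀ d x d' x', M d x + M d' x' = M (d + d') (x + x') := by
    intro d x d' x'
    simp [M]
  have M_mul : ∀ d x d' x', M d x * M d' x' = M (d * x') (x * x') := by
    intro d x d' x'
    ext i j
    fin_cases i <;> fin_cases j <;> simp [M, Matrix.mul_apply]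
  have M_sum : ∀ (n : ℕ) (d x : Fin n → CP R D), M (∑ i, d i) (∑ i, x i) = ∑ i, M (d i) (x i) := by
    intro n d x
    ext i j
    rw [Matrix.sum_apply]
    fin_cases i <;> fin_cases j <;> simp [M]
  obtain ⟨φ, hS, hQ, hP⟩ := CPRing.exists_lift (X := system R D) (K := cpIdeal R D)
    (fun t => M (ofS (r • (t : D.BooleanAlg R)) (Submodule.smul_mem _ r (mem_diag.1 t.2)))
      (ofS t (mem_diag.1 t.2)))
    (fun q => M (ofQ (r • coeQ q) (Submodule.smul_mem _ r (coeQ_mem q))) (ofQ _ (coeQ_mem q)))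
    (fun p => M (ofP (r • coeP p) (Submodule.smul_mem _ r (coeP_mem p))) (ofP _ (coeP_mem p)))
    (fun s t => by
      simp only [M_add, ← ofS_add]
      simp [smul_add])
    (fun s t => by
      simp only [M_mul, ofS_mul_ofS]
      simp [smul_mul_assoc])
    (fun s t => by
      simp only [M_add, ← ofQ_add]
      simp [coeQ_add, smul_add])
    (fun s t => by
      simp only [M_add, ← ofP_add]
      simp [coeP_add, smul_add])
    (fun s t => by
      simp only [M_mul, ofS_mul_ofQ]
      simp [smul_mul_assoc, coeQ_lact])
    (fun s t => by
      simp only [M_mul, ofQ_mul_ofS]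
      simp [smul_mul_assoc, coeQ_ract])
    (fun s t => by
      simp only [M_mul, ofS_mul_ofP]
      simp [smul_mul_assoc, coeP_lact])
    (fun s t => by
      simp only [M_mul, ofP_mul_ofS]
      simp [smul_mul_assoc, coeP_ract])
    (fun s t => by
      simp only [M_mul, ofP_mul_ofQ]
      simp [smul_mul_assoc, coe_pair])
    (fun t ht n q p h => by
      simp only [M_mul]
      rw [← M_sum]
      congr 1
      -- Invariance for the corner entry is invariance for `r t`, which again lies in the ideal
      -- because `qpSpan` is stable under `R`.
      · have hrt : (⟨r • (t : D.BooleanAlg R), Submodule.smul_mem _ r (mem_diag.1 t.2)⟩ : diag R D) ∈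
            cpIdeal R D := mem_cpIdeal.2 (smul_mem_qpSpan r (mem_cpIdeal.1 ht))
        refine CPRing.ofS_eq_sum hrt
          (q := fun i => mkQ (r • coeQ (q i)) (Submodule.smul_mem _ r (coeQ_mem _)))
          (p := p) fun x =>
          coeQ_injective ?_
        have := congrArg coeQ (h x)
        rw [coeQ_lact, coeQ_finRankQ] at this ⊢
        simp only [coeQ_mkQ, smul_mul_assoc, this, ← Finset.smul_sum]
      · exact CPRing.ofS_eq_sum ht h)
  have hφ : ∀ x, φ x 0 0 = 0 ∧ φ x 1 0 = 0 ∧ φ x 1 1 = x := by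
    intro x
    induction x using CP.induction_on with
    | zero => simp
    | add x y hx hy => simp [hx, hy]
    | neg x hx => simp [hx]
    | mul x y hx hy => simp [Matrix.mul_apply, hx, hy]
    | hS a h => exact (hS ⟨a, h⟩).symm ▸ ⟨rfl, rfl, rfl⟩
    | hQ a h => exact (hQ (mkQ a h)).symm ▸ ⟨rfl, rfl, rfl⟩
    | hP a h => exact (hP (mkP a h)).symm ▸ ⟨rfl, rfl, rfl⟩
  refine ⟨fun x => φ x 0 1, fun x y => by simp, fun x y => ?_, fun a h => ?_, fun a h => ?_,
    fun a h => ?_⟩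
  · simp [Matrix.mul_apply, hφ]
  · exact (congrFun (congrFun (hS ⟨a, h⟩) 0) 1)
  · exact (congrFun (congrFun (hQ (mkQ a h)) 0) 1)
  · exact (congrFun (congrFun (hP (mkP a h)) 0) 1)

/-- The multiplication by the scalar `r` on the Cuntz–Pimsner ring. -/
noncomputable def scale (r : R) : CP R D → CP R D := (exists_scale r).choose

theorem scale_add (r : R) (x y : CP R D) : scale r (x + y) = scale r x + scale r y :=
  (exists_scale r).choose_spec.1 x y

theorem scale_mul (r : R) (x y : CP R D) : scale r (x * y) = scale r x * y :=
  (exists_scale r).choose_spec.2.1 x y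

theorem scale_ofS (r : R) (h : a ∈ pSpan R D) :
    scale r (ofS a h) = ofS (r • a) (Submodule.smul_mem _ r h) :=
  (exists_scale r).choose_spec.2.2.1 a h

theorem scale_ofQ (r : R) (h : a ∈ sSpan R D) :
    scale r (ofQ a h) = ofQ (r • a) (Submodule.smul_mem _ r h) :=
  (exists_scale r).choose_spec.2.2.2.1 a h

theorem scale_ofP (r : R) (h : a ∈ sStarSpan R D) :
    scale r (ofP a h) = ofP (r • a) (Submodule.smul_mem _ r h) :=
  (exists_scale r).choose_spec.2.2.2.2 a h

theorem scale_zero (r : R) : scale r (0 : CP R D) = 0 := by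
  simpa using scale_add r (0 : CP R D) 0

theorem scale_neg (r : R) (x : CP R D) : scale r (-x) = -scale r x := by
  rw [eq_neg_iff_add_eq_zero, ← scale_add, neg_add_cancel, scale_zero]

/-- Two additive right-linear maps on the Cuntz–Pimsner ring that agree on the generators are
equal. -/
theorem CP.ext_of_mul {f g : CP R D → CP R D} (hf : ∀ x y, f (x + y) = f x + f y)
    (hg : ∀ x y, g (x + y) = g x + g y) (hf' : ∀ x y, f (x * y) = f x * y)
    (hg' : ∀ x y, g (x * y) = g x * y) (hS : ∀ a h, f (ofS a h) = g (ofS a h))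
    (hQ : ∀ a h, f (ofQ a h) = g (ofQ a h)) (hP : ∀ a h, f (ofP a h) = g (ofP a h)) (x : CP R D) :
    f x = g x := by
  have zero : ∀ {f : CP R D → CP R D}, (∀ x y, f (x + y) = f x + f y) → f 0 = 0 := by
    intro f hf
    simpa using hf 0 0
  have neg : ∀ {f : CP R D → CP R D}, (∀ x y, f (x + y) = f x + f y) → ∀ x, f (-x) = -f x := by
    intro f hf x
    rw [eq_neg_iff_add_eq_zero, ← hf, neg_add_cancel, zero hf]
  induction x using CP.induction_on with
  | zero => rw [zero hf, zero hg]
  | add x y hx hy => rw [hf, hg, hx, hy]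
  | neg x hx => rw [neg hf, neg hg, hx]
  | mul x y hx _ => rw [hf', hg', hx]
  | hS a h => exact hS a h
  | hQ a h => exact hQ a h
  | hP a h => exact hP a h

theorem one_scale (x : CP R D) : scale (1 : R) x = x := by
  refine CP.ext_of_mul (g := id) (scale_add 1) (fun _ _ => rfl) (scale_mul 1) (fun _ _ => rfl)
    ?_ ?_ ?_ x <;> intro a h <;> simp [scale_ofS, scale_ofQ, scale_ofP]

theorem add_scale (r t : R) (x : CP R D) : scale (r + t) x = scale r x + scale t x := by
  refine CP.ext_of_mul (g := fun x => scale r x + scale t x) (scale_add _) ?_ (scale_mul _) ?_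
    ?_ ?_ ?_ x
  · intro x y
    simp only [scale_add]
    abel
  · intro x y
    simp only [scale_mul, add_mul]
  · intro a h
    simp [scale_ofS, ← ofS_add, add_smul]
  · intro a h
    simp [scale_ofQ, ← ofQ_add, add_smul]
  · intro a h
    simp [scale_ofP, ← ofP_add, add_smul]

theorem mul_scale (r t : R) (x : CP R D) : scale (r * t) x = scale r (scale t x) := by
  refine CP.ext_of_mul (g := fun x => scale r (scale t x)) (scale_add _) ?_ (scale_mul _) ?_
    ?_ ?_ ?_ x
  · intro x y
    simp only [scale_add]
  · intro x y
    simp only [scale_mul]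
  · intro a h
    simp [scale_ofS, mul_smul]
  · intro a h
    simp [scale_ofQ, mul_smul]
  · intro a h
    simp [scale_ofP, mul_smul]

/-- Products of two elements of `Q`, or of `Q` and `P`, lie in none of the three pieces, so scalars
cannot be moved by direct computation. Writing `q = q p_A` passes the scalar through the diagonal.
-/
theorem ofQ_mul_scale (r : R) (h : a ∈ sSpan R D) {x : CP R D}
    (hx : ∀ b hb, ofS b hb * scale r x = scale r (ofS b hb * x)) :
    ofQ a h * scale r x = scale r (ofQ a h * x) := by
  obtain ⟨A, hA⟩ := (eventually_mul_p h).exists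
  have e : ofQ a h = ofQ a h * ofS _ (p_mem A) := by simp [ofQ_mul_ofS, hA]
  rw [e, mul_assoc, hx, scale_mul r (ofS _ _), ← mul_assoc, scale_mul, scale_mul,
    scale_ofS, scale_ofQ, ofQ_mul_ofS, ofQ_mul_ofS]
  simp [mul_smul_comm, smul_mul_assoc]

theorem ofS_mul_scale_gen (r : R) (h : a ∈ pSpan R D) {c : D.BooleanAlg R} :
    (∀ hc, ofS a h * scale r (ofS c hc) = scale r (ofS a h * ofS c hc)) ∧
    (∀ hc, ofS a h * scale r (ofQ c hc) = scale r (ofS a h * ofQ c hc)) ∧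
    ∀ hc, ofS a h * scale r (ofP c hc) = scale r (ofS a h * ofP c hc) := by
  refine ⟨fun hc => ?_, fun hc => ?_, fun hc => ?_⟩
  · simp [scale_ofS, ofS_mul_ofS, mul_smul_comm]
  · simp [scale_ofQ, ofS_mul_ofQ, mul_smul_comm]
  · simp [scale_ofP, ofS_mul_ofP, mul_smul_comm]

theorem ofP_mul_scale_gen (r : R) (h : a ∈ sStarSpan R D) {c : D.BooleanAlg R} :
    (∀ hc, ofP a h * scale r (ofS c hc) = scale r (ofP a h * ofS c hc)) ∧
    (∀ hc, ofP a h * scale r (ofQ c hc) = scale r (ofP a h * ofQ c hc)) ∧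
    ∀ hc, ofP a h * scale r (ofP c hc) = scale r (ofP a h * ofP c hc) := by
  refine ⟨fun hc => ?_, fun hc => ?_, fun hc => ?_⟩
  · simp [scale_ofS, scale_ofP, ofP_mul_ofS, mul_smul_comm]
  · simp [scale_ofQ, scale_ofS, ofP_mul_ofQ, mul_smul_comm]
  -- A product of two elements of `P` is not in the three pieces either; a diagonal local unit
  -- between the factors carries the scalar across.
  · obtain ⟨A, hA⟩ := (eventually_p_mul hc).exists
    have e : ofP c hc = ofS _ (p_mem A) * ofP c hc := by simp [ofS_mul_ofP, hA]
    rw [scale_mul r (ofP a h), e, scale_mul, ← mul_assoc, ← mul_assoc, scale_ofS, scale_ofP,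
      ofP_mul_ofS, ofP_mul_ofS]
    simp [mul_smul_comm, smul_mul_assoc]

theorem mul_scale_of_gen (r : R) {x : CP R D}
    (hS : ∀ c hc, x * scale r (ofS c hc) = scale r (x * ofS c hc))
    (hQ : ∀ c hc, x * scale r (ofQ c hc) = scale r (x * ofQ c hc))
    (hP : ∀ c hc, x * scale r (ofP c hc) = scale r (x * ofP c hc)) (y : CP R D) :
    x * scale r y = scale r (x * y) := by
  refine CP.ext_of_mul (f := fun y => x * scale r y) (g := fun y => scale r (x * y))
    ?_ ?_ ?_ ?_ hS hQ hP y <;> intro y z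
  · simp only [scale_add, mul_add]
  · simp only [scale_add, mul_add]
  · simp only [scale_mul, mul_assoc]
  · simp only [← mul_assoc, scale_mul]

/-- By construction scaling commutes only with right multiplication. Commutation with left
multiplication is what makes the Cuntz–Pimsner ring an `R`-algebra, as the presentation of `L_R(𝓑,
Λ, θ, 𝓘)` demands of a target. -/
theorem mul_scale_comm (r : R) (x y : CP R D) : x * scale r y = scale r (x * y) := by
  have hS : ∀ a h (y : CP R D), ofS a h * scale r y = scale r (ofS a h * y) := fun a h =>
    mul_scale_of_gen r (fun c => (ofS_mul_scale_gen r h).1) (fun c => (ofS_mul_scale_gen r h).2.1)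
      fun c => (ofS_mul_scale_gen r h).2.2
  induction x using CP.induction_on generalizing y with
  | zero => rw [zero_mul, zero_mul, scale_zero]
  | add x x' hx hx' => rw [add_mul, add_mul, scale_add, hx, hx']
  | neg x hx => rw [neg_mul, neg_mul, scale_neg, hx]
  | mul x x' hx hx' => rw [mul_assoc, mul_assoc, hx', hx]
  | hS a h => exact hS a h y
  | hQ a h => exact ofQ_mul_scale r h fun b hb => hS b hb y
  | hP a h =>
    exact mul_scale_of_gen r (fun c => (ofP_mul_scale_gen r h).1)
      (fun c => (ofP_mul_scale_gen r h).2.1) (fun c => (ofP_mul_scale_gen r h).2.2) y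

/-- The Cuntz–Pimsner ring is an `R`-module. -/
@[reducible]
noncomputable def moduleCP : Module R (CP R D) where
  smul := scale
  one_smul := one_scale
  mul_smul := mul_scale
  smul_zero := scale_zero
  smul_add := scale_add
  add_smul := add_scale
  zero_smul x := by
    have := add_scale (0 : R) 0 x
    rw [add_zero] at this
    exact left_eq_add.1 this

/-! ### The isomorphism -/

theorem ofS_congr {h : a ∈ pSpan R D} (e : a = b) : ofS a h = ofS b (e ▸ h) := by
  subst e
  rfl

theorem ofQ_congr {h : a ∈ sSpan R D} (e : a = b) : ofQ a h = ofQ b (e ▸ h) := by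
  subst e
  rfl

theorem ofP_congr {h : a ∈ sStarSpan R D} (e : a = b) : ofP a h = ofP b (e ▸ h) := by
  subst e
  rfl

/-- All relations but the last are computations within the system; the regular relation is
invariance, as `p_A` lies in the ideal for regular `A`. Linearity over `R` extends the values on
generators to the three spans. -/
theorem exists_toCP : ∃ φ : D.BooleanAlg R → CP R D, (∀ x y, φ (x + y) = φ x + φ y) ∧
    (∀ x y, φ (x * y) = φ x * φ y) ∧ (∀ a h, φ a = ofS a h) ∧ (∀ a h, φ a = ofQ a h) ∧
    ∀ a h, φ a = ofP a h := by
  let := moduleCP (R := R) (D := D)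
  have : IsScalarTower R (CP R D) (CP R D) := ⟨fun r x y => (scale_mul r x y).symm⟩
  have : SMulCommClass R (CP R D) (CP R D) := ⟨fun r x y => (mul_scale_comm r x y).symm⟩
  obtain ⟨φ, hp, hs, hsStar⟩ := exists_lift (R := R) (D := D) (A := CP R D)
    (fun A => ofS _ (p_mem A)) (fun α B => ofQ _ (s_mem α B)) (fun α B => ofP _ (sStar_mem α B))
    ((ofS_congr (p_bot R D)).trans CPRing.ofS_zero)
    (fun A B => by rw [ofS_mul_ofS]; exact ofS_congr (p_inf R D A B))
    (fun A B => by
      rw [eq_sub_iff_add_eq, ← ofS_add, ← ofS_add]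
      refine ofS_congr ?_
      rw [p_sup, sub_add_cancel])
    (fun C α B => by rw [ofS_mul_ofQ, ofQ_mul_ofS]; exact ofQ_congr (p_mul_s R D C α B))
    (fun C α B => by rw [ofP_mul_ofS, ofS_mul_ofP]; exact ofP_congr (sStar_mul_p R D C α B))
    (fun α B B' => by rw [ofP_mul_ofQ]; exact ofS_congr (sStar_mul_s R D α B B'))
    (fun α α' B B' h => by
      rw [ofP_mul_ofQ]; exact (ofS_congr (sStar_mul_s_of_ne R D h B B')).trans CPRing.ofS_zero)
    (fun α B B' => by rw [ofQ_mul_ofS]; exact ofQ_congr (s_mul_p R D α B B'))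
    (fun α B B' => by rw [ofS_mul_ofP]; exact ofP_congr (p_mul_sStar R D α B B'))
    (fun A hA F hF => by
      have hmem : (⟨p R D A, p_mem A⟩ : diag R D) ∈ cpIdeal R D := mem_cpIdeal.2 (p_mem_qpSpan hA)
      have hsum : ∀ g : Λ → CP R D, ∑ α ∈ F, g α = ∑ i, g (F.equivFin.symm i) := by
        intro g
        rw [← Finset.sum_coe_sort]
        exact (Equiv.sum_comp F.equivFin.symm (fun i => g i)).symm
      rw [hsum]
      refine CPRing.ofS_eq_sum hmem (q := fun i => mkQ _ (s_mem _ _))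
        (p := fun i => mkP _ (sStar_mem _ _)) fun x => coeQ_injective ?_
      rw [coeQ_lact, coeQ_finRankQ]
      congr 1
      simp only [coeQ_mkQ, coeP_mkP]
      rw [p_regular R D hA hF, ← Finset.sum_coe_sort]
      exact (Equiv.sum_comp F.equivFin.symm
        (fun i => s R D i (D.img i A) * sStar R D i (D.img i A))).symm)
  have hsmul : ∀ (r : R) (x : CP R D), r • x = scale r x := fun _ _ => rfl
  refine ⟨φ, map_add φ, map_mul φ, fun a h => ?_, fun a h => ?_, fun a h => ?_⟩
  · induction h using Submodule.span_induction with
    | mem a ha =>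
      obtain ⟨A, rfl⟩ := ha
      exact hp A
    | zero => rw [map_zero]; exact CPRing.ofS_zero.symm
    | add x y hx hy h1 h2 => rw [map_add, h1, h2]; exact (ofS_add hx hy).symm
    | smul r x hx h1 => rw [map_smul, h1, hsmul]; exact scale_ofS r hx
  · induction h using Submodule.span_induction with
    | mem a ha =>
      obtain ⟨α, B, rfl⟩ := ha
      exact hs α B
    | zero => rw [map_zero]; exact CPRing.ofQ_zero.symm
    | add x y hx hy h1 h2 => rw [map_add, h1, h2]; exact (ofQ_add hx hy).symm
    | smul r x hx h1 => rw [map_smul, h1, hsmul]; exact scale_ofQ r hx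
  · induction h using Submodule.span_induction with
    | mem a ha =>
      obtain ⟨α, B, rfl⟩ := ha
      exact hsStar α B
    | zero => rw [map_zero]; exact CPRing.ofP_zero.symm
    | add x y hx hy h1 h2 => rw [map_add, h1, h2]; exact (ofP_add hx hy).symm
    | smul r x hx h1 => rw [map_smul, h1, hsmul]; exact scale_ofP r hx

theorem exists_ofCP : ∃ ψ : CP R D →ₙ+* D.BooleanAlg R, (∀ a h, ψ (ofS a h) = a) ∧
    (∀ a h, ψ (ofQ a h) = a) ∧ ∀ a h, ψ (ofP a h) = a := by
  obtain ⟨ψ, hS, hQ, hP⟩ := CPRing.exists_lift (X := system R D) (K := cpIdeal R D)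
    (fun t => (t : D.BooleanAlg R)) coeQ coeP (fun _ _ => rfl) (fun _ _ => rfl) coeQ_add coeP_add
    coeQ_lact coeQ_ract coeP_lact coeP_ract coe_pair
    (fun t ht n q p h => coe_eq_sum_of_lact_eq ht h)
  exact ⟨ψ, fun a h => hS ⟨a, h⟩, fun a h => hQ (mkQ a h), fun a h => hP (mkP a h)⟩

theorem ofS_mem_grading (h : a ∈ pSpan R D) :
    ofS a h ∈ (system R D).grading (cpIdeal R D) 0 :=
  CPRing.ofS_mem _

theorem ofQ_mem_grading (h : a ∈ sSpan R D) :
    ofQ a h ∈ (system R D).grading (cpIdeal R D) 1 :=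
  CPRing.ofQ_mem _

theorem ofP_mem_grading (h : a ∈ sStarSpan R D) :
    ofP a h ∈ (system R D).grading (cpIdeal R D) (-1) :=
  CPRing.ofP_mem _

theorem mem_grading_of_mem_span {s : Set (D.BooleanAlg R)} {n : ℤ}
    (h : ∀ a ∈ s, a ∈ D.grading R n) (ha : a ∈ Submodule.span R s) : a ∈ D.grading R n := by
  induction ha using Submodule.closure_induction with
  | zero => exact zero_mem _
  | add x y _ _ hx hy => exact add_mem hx hy
  | smul_mem r x hx => exact smul_mem_grading r (h x hx)

theorem mem_grading_of_mem_pSpan (h : a ∈ pSpan R D) : a ∈ D.grading R 0 := by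
  refine mem_grading_of_mem_span ?_ h
  rintro _ ⟨A, rfl⟩
  exact p_mem_grading A

theorem mem_grading_of_mem_sSpan (h : a ∈ sSpan R D) : a ∈ D.grading R 1 := by
  refine mem_grading_of_mem_span ?_ h
  rintro _ ⟨α, B, rfl⟩
  exact s_mem_grading α B

theorem mem_grading_of_mem_sStarSpan (h : a ∈ sStarSpan R D) : a ∈ D.grading R (-1) := by
  refine mem_grading_of_mem_span ?_ h
  rintro _ ⟨α, B, rfl⟩
  exact sStar_mem_grading α B

/-- Words are lifted letter by letter, and a scalar is absorbed in its letter because the three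
spans are `R`-submodules. -/
theorem grading_le_map {ψ : CP R D →ₙ+* D.BooleanAlg R} (hS : ∀ a h, ψ (ofS a h) = a)
    (hQ : ∀ a h, ψ (ofQ a h) = a) (hP : ∀ a h, ψ (ofP a h) = a) {n : ℤ} {a : D.BooleanAlg R}
    (ha : a ∈ D.grading R n) : ∃ x ∈ (system R D).grading (cpIdeal R D) n, ψ x = a := by
  have hmul : ∀ {k n : ℤ} {x : CP R D} {a b : D.BooleanAlg R},
      x ∈ (system R D).grading (cpIdeal R D) k → ψ x = b →
      (∃ y ∈ (system R D).grading (cpIdeal R D) n, ψ y = a) →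
      ∃ y ∈ (system R D).grading (cpIdeal R D) (k + n), ψ y = b * a := by
    rintro k n x _ _ hx rfl ⟨y, hy, rfl⟩
    exact ⟨x * y, PresentedAlgebra.mul_mem_component hx hy, map_mul ψ x y⟩
  refine PresentedAlgebra.component_induction (motive := fun n a =>
    ∃ x ∈ (system R D).grading (cpIdeal R D) n, ψ x = a) ?_ ?_ ?_ ?_ ha
  · exact fun n => ⟨0, zero_mem _, map_zero ψ⟩
  · rintro n _ _ ⟨x, hx, rfl⟩ ⟨y, hy, rfl⟩
    exact ⟨x + y, add_mem hx hy, map_add ψ x y⟩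
  · rintro r (A | ⟨α, B⟩ | ⟨α, B⟩)
    · exact ⟨_, ofS_mem_grading _, hS _ (Submodule.smul_mem _ r (p_mem A))⟩
    · exact ⟨_, ofQ_mem_grading _, hQ _ (Submodule.smul_mem _ r (s_mem α B))⟩
    · exact ⟨_, ofP_mem_grading _, hP _ (Submodule.smul_mem _ r (sStar_mem α B))⟩
  · rintro (A | ⟨α, B⟩ | ⟨α, B⟩) n a ha
    · exact hmul (ofS_mem_grading _) (hS _ (p_mem A)) ha
    · exact hmul (ofQ_mem_grading _) (hQ _ (s_mem α B)) ha
    · exact hmul (ofP_mem_grading _) (hP _ (sStar_mem α B)) ha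

theorem map_mem_grading {ψ : CP R D →ₙ+* D.BooleanAlg R} (hS : ∀ a h, ψ (ofS a h) = a)
    (hQ : ∀ a h, ψ (ofQ a h) = a) (hP : ∀ a h, ψ (ofP a h) = a) {n : ℤ} {x : CP R D}
    (hx : x ∈ (system R D).grading (cpIdeal R D) n) : ψ x ∈ D.grading R n := by
  have gen : ∀ g : (system R D).Gen,
      ψ (PresentedAlgebra.gen ℤ _ g) ∈ D.grading R (RingSystem.Gen.deg g) := by
    rintro (t | q | p)
    · exact (hS _ (mem_diag.1 t.2)).symm ▸ mem_grading_of_mem_pSpan t.2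
    · exact (hQ _ (coeQ_mem q)).symm ▸ mem_grading_of_mem_sSpan (coeQ_mem q)
    · exact (hP _ (coeP_mem p)).symm ▸ mem_grading_of_mem_sStarSpan (coeP_mem p)
  refine PresentedAlgebra.component_induction (motive := fun n x => ψ x ∈ D.grading R n)
    ?_ ?_ ?_ ?_ hx
  · intro n
    rw [map_zero]
    exact zero_mem _
  · intro n x y hx hy
    rw [map_add]
    exact add_mem hx hy
  · intro r g
    refine (congrArg (fun x => ψ x ∈ D.grading R _) (int_smul_eq_zsmul _ r _)).mpr ?_
    rw [map_zsmul]
    exact zsmul_mem (gen g) r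
  · intro g n x hx
    rw [map_mul]
    exact PresentedAlgebra.mul_mem_component (gen g) hx

theorem gradedIsomorphic : GradedIsomorphic (D.grading R)
    ((system R D).grading (cpIdeal R D)) := by
  refine ⟨D.isIntGrading_grading R, RingSystem.isIntGrading_grading _ _, ?_⟩
  obtain ⟨φ, φ_add, φ_mul, φS, φQ, φP⟩ := exists_toCP (R := R) (D := D)
  obtain ⟨ψ, hS, hQ, hP⟩ := exists_ofCP (R := R) (D := D)
  have φ_zero : φ 0 = 0 := by simpa using φ_add 0 0
  have φ_neg : ∀ x, φ (-x) = -φ x := by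
    intro x
    rw [eq_neg_iff_add_eq_zero, ← φ_add, neg_add_cancel, φ_zero]
  -- On the images of `S`, `Q` and `P` the map `ψ` returns the underlying element and `φ` sends it
  -- back; both maps are ring homomorphisms.
  have hφψ : ∀ x, φ (ψ x) = x := by
    intro x
    induction x using CP.induction_on with
    | zero => rw [map_zero, φ_zero]
    | add x y hx hy => rw [map_add, φ_add, hx, hy]
    | neg x hx => rw [map_neg, φ_neg, hx]
    | mul x y hx hy => rw [map_mul, φ_mul, hx, hy]
    | hS a h => rw [hS, φS a h]
    | hQ a h => rw [hQ, φQ a h]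
    | hP a h => rw [hP, φP a h]
  have hsurj : Function.Surjective ψ := by
    intro a
    have ha : a ∈ ⨆ n, D.grading R n := by
      rw [iSup_grading]
      trivial
    refine AddSubgroup.iSup_induction _ (C := fun a => ∃ x, ψ x = a) ha ?_ ⟨0, map_zero ψ⟩ ?_
    · intro n a ha
      obtain ⟨x, -, hx⟩ := grading_le_map hS hQ hP ha
      exact ⟨x, hx⟩
    · rintro _ _ ⟨x, rfl⟩ ⟨y, rfl⟩
      exact ⟨x + y, map_add ψ x y⟩
  -- A right inverse of the other composite suffices once `ψ` is known to be surjective.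
  have hψφ : ∀ a, ψ (φ a) = a := by
    intro a
    obtain ⟨x, rfl⟩ := hsurj a
    rw [hφψ]
  refine ⟨{ toFun := φ, invFun := ψ, left_inv := hψφ, right_inv := hφψ, map_mul' := φ_mul,
            map_add' := φ_add }, fun n => le_antisymm ?_ ?_⟩
  · rintro _ ⟨a, ha, rfl⟩
    obtain ⟨x, hx, rfl⟩ := grading_le_map hS hQ hP ha
    change φ (ψ x) ∈ _
    rwa [hφψ]
  · intro x hx
    exact ⟨ψ x, map_mem_grading hS hQ hP hx, hφψ x⟩

end BooleanAlg

end GenBooleanDynSystem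

theorem mainTheorem3 {𝓑 : Type*} [GeneralizedBooleanAlgebra 𝓑] {Λ : Type*}
    (D : GenBooleanDynSystem 𝓑 Λ) (R : Type*) [CommRing R] :
    ∃ (S : NonUnitalSubring (D.BooleanAlg R)) (X : RingSystem S) (K : TwoSidedIdeal S),
      X.IsCPIdeal K ∧ GradedIsomorphic (D.grading R) (X.grading K) :=
  ⟨_, _, _, GenBooleanDynSystem.BooleanAlg.isCPIdeal_cpIdeal,
    GenBooleanDynSystem.BooleanAlg.gradedIsomorphic⟩
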